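/- Let $G$ be a three-dimensional (real, smooth) Lie group, let $I\subset\mathbb R$ be an interval with more than one point, and for each $t\in I$ let $\{e^1(t),e^2(t),e^3(t)\}$ be a global basis of 1-forms on $G$ (not necessarily left-invariant), depending smoothly on $(x,t)\in G\times I$. Let $f:I\to\mathbb R$ be a smooth nowhere vanishing function, and write $e^{ij}(t)=e^i(t)\wedge e^j(t)$. An almost hyper-parahermitian structure $(g,J,P_1,P_2)$ on a manifold consists of a pseudo-Riemannian metric $g$ and endomorphisms $J,P_1,P_2$ of the tangent bundle with $J^2=-P_1^2=-P_2^2=-\mathrm{Id}$, $JP_1=-P_1J=P_2$ and $g(J\cdot,J\cdot)=-g(P_1\cdot,P_1\cdot)=-g(P_2\cdot,P_2\cdot)=g(\cdot,\cdot)$. Its fundamental 2-forms are $\Omega_1=g(\cdot,J\cdot)$, $\Omega_2=g(\cdot,P_1\cdot)$, $\Omega_3=g(\cdot,P_2\cdot)$, and it is called hyper-symplectic if $d\Omega_1=d\Omega_2=d\Omega_3=0$. On $G\times I$ there is exactly one almost hyper-parahermitian structure whose fundamental 2-forms are $$\Omega_1=-e^1(t)\wedge e^2(t)+e^3(t)\wedge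 f(t)\,dt,\quad \Omega_2=e^1(t)\wedge e^3(t)-e^2(t)\wedge f(t)\,dt,\quad \Omega_3=e^2(t)\wedge e^3(t)+e^1(t)\wedge f(t)\,dt.$$ This structure is hyper-symplectic if and only if $$de^{12}(t_0)=de^{13}(t_0)=de^{23}(t_0)=0\quad\text{on } G \text{ for some } t_0\in I,$$ and, for all $t\in I$, the evolution equations $$\frac{\partial}{\partial t}e^{12}(t)=f(t)\,de^3(t),\qquad \frac{\partial}{\partial t}e^{13}(t)=f(t)\,de^2(t),\qquad \frac{\partial}{\partial t}e^{23}(t)=-f(t)\,de^1(t)$$ hold, where $d$ is the exterior derivative on $G$. Its metric is $$g=(e^1(t))^2+(e^2(t))^2-(e^3(t))^2-f(t)^2\,dt^2,$$ which has signature $(2,2)$. -/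

import Mathlib

open Set Bundle
open scoped Manifold ContDiff Topology

noncomputable section

/-! ### Alternating 2-forms on a real topological vector space -/

section LinearAlgebra

variable {V : Type*} [AddCommGroup V] [Module ℝ V] [TopologicalSpace V]

/-- A bilinear map `b` with `b v v = 0` for all `v`, given as a continuous function of pairs,
as an alternating 2-form. -/
def twoFormOf (b : V →ₗ[ℝ] V →ₗ[ℝ] ℝ) (hcont : Continuous fun v : Fin 2 → V => b (v 0) (v 1))
    (halt : ∀ v, b v v = 0) : V [⋀^Fin 2]→L[ℝ] ℝ where
  toFun v := b (v 0) (v 1)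
  map_update_add' := by
    intro inst v i x y
    obtain rfl : inst = instDecidableEqFin 2 := Subsingleton.elim _ _
    fin_cases i <;> simp [Function.update]
  map_update_smul' := by
    intro inst v i c x
    obtain rfl : inst = instDecidableEqFin 2 := Subsingleton.elim _ _
    fin_cases i <;> simp [Function.update]
  cont := hcont
  map_eq_zero_of_eq' v i j hij hne := by
    fin_cases i <;> fin_cases j <;> simp_all

@[simp] theorem twoFormOf_apply (b : V →ₗ[ℝ] V →ₗ[ℝ] ℝ)
    (hcont : Continuous fun v : Fin 2 → V => b (v 0) (v 1)) (halt : ∀ v, b v v = 0)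
    (v : Fin 2 → V) : twoFormOf b hcont halt v = b (v 0) (v 1) := rfl

/-- The wedge product of two covectors: `(α ∧ β)(v, w) = α v * β w - α w * β v`. -/
def wedge (α β : V →L[ℝ] ℝ) : V [⋀^Fin 2]→L[ℝ] ℝ :=
  twoFormOf
    (LinearMap.mk₂ ℝ (fun v w => α v * β w - α w * β v)
      (by intros; simp; ring) (by intros; simp; ring) (by intros; simp; ring)
      (by intros; simp; ring))
    (by simp only [LinearMap.mk₂_apply]; fun_prop)
    (by intro v; simp [LinearMap.mk₂_apply])

@[simp] theorem wedge_apply (α β : V →L[ℝ] ℝ) (v : Fin 2 → V) :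
    wedge α β v = α (v 0) * β (v 1) - α (v 1) * β (v 0) := rfl

end LinearAlgebra

section Manifold

variable {E : Type*} [NormedAddCommGroup E] [NormedSpace ℝ E]
  {H : Type*} [TopologicalSpace H] (I : ModelWithCorners ℝ E H)
  {M : Type*} [TopologicalSpace M] [ChartedSpace H M]

/-! ### Exterior derivative on a manifold -/

/-- A differential `k`-form `θ` read in a chart `φ` around `x₀`, i.e. the pullback of `θ` under
`φ⁻¹`, as a `k`-form on the model vector space. -/
def formInChart {k : ℕ} (θ : (x : M) → TangentSpace I x [⋀^Fin k]→L[ℝ] ℝ) (x₀ : M) (y : E) :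
    E [⋀^Fin k]→L[ℝ] ℝ :=
  (θ ((extChartAt I x₀).symm y)).compContinuousLinearMap
    (mfderivWithin 𝓘(ℝ, E) I (extChartAt I x₀).symm (range I) y)

/-- The exterior derivative, along a subset `s` of the manifold `M`, of a differential `k`-form:
near `x₀`, read the form in the chart, take the exterior derivative in the model vector space, and
pull the result back to `M` by the chart. -/
def extDerivOn {k : ℕ} (s : Set M) (θ : (x : M) → TangentSpace I x [⋀^Fin k]→L[ℝ] ℝ) (x₀ : M) :
    TangentSpace I x₀ [⋀^Fin (k + 1)]→L[ℝ] ℝ :=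
  (extDerivWithin (formInChart I θ x₀) ((extChartAt I x₀).symm ⁻¹' s ∩ range I)
    (extChartAt I x₀ x₀)).compContinuousLinearMap (mfderiv I 𝓘(ℝ, E) (extChartAt I x₀) x₀)

/-- The form `θ` is closed on `s`. -/
def ClosedOn {k : ℕ} (s : Set M) (θ : (x : M) → TangentSpace I x [⋀^Fin k]→L[ℝ] ℝ) : Prop :=
  ∀ x ∈ s, extDerivOn I s θ x = 0

/-- The exterior derivative on `M` of a field of covectors. -/
def extDerivCovector (α : (x : M) → TangentSpace I x →L[ℝ] ℝ) (x₀ : M) :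
    TangentSpace I x₀ [⋀^Fin 2]→L[ℝ] ℝ :=
  extDerivOn (k := 1) I univ
    (fun x => ContinuousAlternatingMap.ofSubsingleton ℝ (TangentSpace I x) ℝ (0 : Fin 1) (α x)) x₀

/-! ### Almost hyper-parahermitian and hyper-symplectic structures -/

variable [IsManifold I ∞ M]

/-- An almost hyper-parahermitian structure `(g, J, P₁, P₂)` on the subset `s` of `M`: a smooth
pseudo-Riemannian metric and smooth endomorphisms of the tangent bundle over `s` such that
`J² = -P₁² = -P₂² = -1`, `J P₁ = -P₁ J = P₂` and
`g(J·,J·) = -g(P₁·,P₁·) = -g(P₂·,P₂·) = g`. The values outside `s` are irrelevant. -/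
structure AlmostHyperParahermitian (s : Set M) where
  /-- the metric -/
  g : (x : M) → TangentSpace I x →L[ℝ] TangentSpace I x →L[ℝ] ℝ
  /-- the almost complex structure -/
  J : (x : M) → TangentSpace I x →L[ℝ] TangentSpace I x
  /-- the first almost product structure -/
  P₁ : (x : M) → TangentSpace I x →L[ℝ] TangentSpace I x
  /-- the second almost product structure -/
  P₂ : (x : M) → TangentSpace I x →L[ℝ] TangentSpace I x
  smooth_g : ContMDiffOn I (I.prod 𝓘(ℝ, E →L[ℝ] E →L[ℝ] ℝ)) ∞
    (fun x => TotalSpace.mk' (E →L[ℝ] E →L[ℝ] ℝ)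
      (E := fun x : M => TangentSpace I x →L[ℝ] TangentSpace I x →L[ℝ] ℝ) x (g x)) s
  smooth_J : ContMDiffOn I (I.prod 𝓘(ℝ, E →L[ℝ] E)) ∞
    (fun x => TotalSpace.mk' (E →L[ℝ] E)
      (E := fun x : M => TangentSpace I x →L[ℝ] TangentSpace I x) x (J x)) s
  smooth_P₁ : ContMDiffOn I (I.prod 𝓘(ℝ, E →L[ℝ] E)) ∞
    (fun x => TotalSpace.mk' (E →L[ℝ] E)
      (E := fun x : M => TangentSpace I x →L[ℝ] TangentSpace I x) x (P₁ x)) s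
  smooth_P₂ : ContMDiffOn I (I.prod 𝓘(ℝ, E →L[ℝ] E)) ∞
    (fun x => TotalSpace.mk' (E →L[ℝ] E)
      (E := fun x : M => TangentSpace I x →L[ℝ] TangentSpace I x) x (P₂ x)) s
  symm : ∀ x ∈ s, ∀ v w, g x v w = g x w v
  nondegenerate : ∀ x ∈ s, ∀ v, (∀ w, g x v w = 0) → v = 0
  J_sq : ∀ x ∈ s, ∀ v, J x (J x v) = -v
  P₁_sq : ∀ x ∈ s, ∀ v, P₁ x (P₁ x v) = v
  P₂_sq : ∀ x ∈ s, ∀ v, P₂ x (P₂ x v) = v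
  J_P₁ : ∀ x ∈ s, ∀ v, J x (P₁ x v) = P₂ x v
  P₁_J : ∀ x ∈ s, ∀ v, P₁ x (J x v) = -P₂ x v
  g_J : ∀ x ∈ s, ∀ v w, g x (J x v) (J x w) = g x v w
  g_P₁ : ∀ x ∈ s, ∀ v w, g x (P₁ x v) (P₁ x w) = -g x v w
  g_P₂ : ∀ x ∈ s, ∀ v w, g x (P₂ x v) (P₂ x w) = -g x v w

namespace AlmostHyperParahermitian

variable {I} {s : Set M} (A : AlmostHyperParahermitian I s)

theorem g_J_self {x : M} (hx : x ∈ s) (v : TangentSpace I x) : A.g x v (A.J x v) = 0 := by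
  have h := A.g_J x hx v (A.J x v)
  rw [A.J_sq x hx, map_neg, A.symm x hx] at h
  linarith

theorem g_P₁_self {x : M} (hx : x ∈ s) (v : TangentSpace I x) : A.g x v (A.P₁ x v) = 0 := by
  have h := A.g_P₁ x hx v (A.P₁ x v)
  rw [A.P₁_sq x hx, A.symm x hx] at h
  linarith

theorem g_P₂_self {x : M} (hx : x ∈ s) (v : TangentSpace I x) : A.g x v (A.P₂ x v) = 0 := by
  have h := A.g_P₂ x hx v (A.P₂ x v)
  rw [A.P₂_sq x hx, A.symm x hx] at h
  linarith

/-- For `K` one of `J`, `P₁`, `P₂`: the 2-form `g(·, K·)` on `s` (extended by `0`). -/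
def formOf (K : (x : M) → TangentSpace I x →L[ℝ] TangentSpace I x)
    (hK : ∀ x ∈ s, ∀ v, A.g x v (K x v) = 0) (x : M) : TangentSpace I x [⋀^Fin 2]→L[ℝ] ℝ :=
  open Classical in
  if hx : x ∈ s then
    twoFormOf
      (LinearMap.mk₂ ℝ (fun v w => A.g x v (K x w))
        (by intros; simp) (by intros; simp) (by intros; simp) (by intros; simp))
      (by
        have h : Continuous fun v : Fin 2 → E =>
            (show E →L[ℝ] E →L[ℝ] ℝ from A.g x) (v 0) ((show E →L[ℝ] E from K x) (v 1)) := by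
          fun_prop
        exact h)
      (hK x hx)
  else 0

/-- The fundamental 2-form `Ω₁ = g(·, J·)`. -/
def Ω₁ (x : M) : TangentSpace I x [⋀^Fin 2]→L[ℝ] ℝ := A.formOf A.J (fun _ hx => A.g_J_self hx) x

/-- The fundamental 2-form `Ω₂ = g(·, P₁·)`. -/
def Ω₂ (x : M) : TangentSpace I x [⋀^Fin 2]→L[ℝ] ℝ := A.formOf A.P₁ (fun _ hx => A.g_P₁_self hx) x

/-- The fundamental 2-form `Ω₃ = g(·, P₂·)`. -/
def Ω₃ (x : M) : TangentSpace I x [⋀^Fin 2]→L[ℝ] ℝ := A.formOf A.P₂ (fun _ hx => A.g_P₂_self hx) x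

/-- The structure is hyper-symplectic if its three fundamental 2-forms are closed. -/
def IsHyperSymplectic : Prop := ClosedOn I s A.Ω₁ ∧ ClosedOn I s A.Ω₂ ∧ ClosedOn I s A.Ω₃

/-- The three fundamental 2-forms of the structure are the given ones on `s`. -/
def HasFundamentalForms (θ₁ θ₂ θ₃ : (x : M) → TangentSpace I x [⋀^Fin 2]→L[ℝ] ℝ) : Prop :=
  ∀ x ∈ s, A.Ω₁ x = θ₁ x ∧ A.Ω₂ x = θ₂ x ∧ A.Ω₃ x = θ₃ x

/-- The quadratic form `v ↦ g(v, v)` on the tangent space at `x`. -/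
def quadraticForm (x : M) : QuadraticForm ℝ (TangentSpace I x) :=
  LinearMap.BilinMap.toQuadraticMap
    (LinearMap.mk₂ ℝ (fun v w => A.g x v w)
      (by intros; simp) (by intros; simp) (by intros; simp) (by intros; simp))

end AlmostHyperParahermitian

end Manifold

/-! ### Time-dependent coframes on a 3-manifold and the induced forms on `G × T` -/

section Evolution

variable {G : Type*} [TopologicalSpace G] [ChartedSpace (EuclideanSpace ℝ (Fin 3)) G]

/-- `e` is a family, smooth in `(x, t) ∈ G × T`, of global bases of 1-forms
`e 0 t = e¹(t)`, `e 1 t = e²(t)`, `e 2 t = e³(t)` on `G`, for `t ∈ T`. -/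
structure IsSmoothCoframe [IsManifold (𝓡 3) ∞ G] (T : Set ℝ)
    (e : Fin 3 → ℝ → (x : G) → TangentSpace (𝓡 3) x →L[ℝ] ℝ) : Prop where
  smooth : ∀ i, ContMDiffOn ((𝓡 3).prod 𝓘(ℝ, ℝ))
    ((𝓡 3).prod 𝓘(ℝ, EuclideanSpace ℝ (Fin 3) →L[ℝ] ℝ)) ∞
    (fun p : G × ℝ => TotalSpace.mk' (EuclideanSpace ℝ (Fin 3) →L[ℝ] ℝ)
      (E := fun x : G => TangentSpace (𝓡 3) x →L[ℝ] ℝ) p.1 (e i p.2 p.1)) (univ ×ˢ T)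
  linearIndependent : ∀ t ∈ T, ∀ x, LinearIndependent ℝ fun i => e i t x
  span : ∀ t ∈ T, ∀ x, Submodule.span ℝ (range fun i => e i t x) = ⊤

/-- The time-dependent 1-form `α(t)` on `G`, as a 1-form on `G × ℝ`. -/
def spatial (α : ℝ → (x : G) → TangentSpace (𝓡 3) x →L[ℝ] ℝ) (p : G × ℝ) :
    TangentSpace ((𝓡 3).prod 𝓘(ℝ, ℝ)) p →L[ℝ] ℝ :=
  (α p.2 p.1).comp (mfderiv ((𝓡 3).prod 𝓘(ℝ, ℝ)) (𝓡 3) (Prod.fst : G × ℝ → G) p)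

/-- The 1-form `f(t) dt` on `G × ℝ`. -/
def temporal (f : ℝ → ℝ) (p : G × ℝ) : TangentSpace ((𝓡 3).prod 𝓘(ℝ, ℝ)) p →L[ℝ] ℝ :=
  f p.2 • ((NormedSpace.fromTangentSpace (𝕜 := ℝ) p.2).toContinuousLinearMap.comp
    (mfderiv ((𝓡 3).prod 𝓘(ℝ, ℝ)) 𝓘(ℝ, ℝ) (Prod.snd : G × ℝ → ℝ) p))

/-- The time-dependent 2-form `eⁱʲ(t) = eⁱ(t) ∧ eʲ(t)` on `G`. -/
def coframeWedge (e : Fin 3 → ℝ → (x : G) → TangentSpace (𝓡 3) x →L[ℝ] ℝ) (i j : Fin 3) (t : ℝ)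
    (x : G) : TangentSpace (𝓡 3) x [⋀^Fin 2]→L[ℝ] ℝ :=
  wedge (e i t x) (e j t x)

/-- `∂θ/∂t = η` on `G` for all `t ∈ T` (at each point of `G`, evaluated on tangent vectors). -/
def HasTimeDerivOn (T : Set ℝ) (θ η : ℝ → (x : G) → TangentSpace (𝓡 3) x [⋀^Fin 2]→L[ℝ] ℝ) :
    Prop :=
  ∀ t ∈ T, ∀ (x : G) (v : Fin 2 → TangentSpace (𝓡 3) x),
    HasDerivWithinAt (fun r => θ r x v) (η t x v) T t

/-- `-e¹ ∧ e² + e³ ∧ f dt`. -/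
def evolΩ₁ (e : Fin 3 → ℝ → (x : G) → TangentSpace (𝓡 3) x →L[ℝ] ℝ) (f : ℝ → ℝ) (p : G × ℝ) :
    TangentSpace ((𝓡 3).prod 𝓘(ℝ, ℝ)) p [⋀^Fin 2]→L[ℝ] ℝ :=
  -wedge (spatial (e 0) p) (spatial (e 1) p) + wedge (spatial (e 2) p) (temporal f p)

/-- `e¹ ∧ e³ - e² ∧ f dt`. -/
def evolΩ₂ (e : Fin 3 → ℝ → (x : G) → TangentSpace (𝓡 3) x →L[ℝ] ℝ) (f : ℝ → ℝ) (p : G × ℝ) :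
    TangentSpace ((𝓡 3).prod 𝓘(ℝ, ℝ)) p [⋀^Fin 2]→L[ℝ] ℝ :=
  wedge (spatial (e 0) p) (spatial (e 2) p) - wedge (spatial (e 1) p) (temporal f p)

/-- `e² ∧ e³ + e¹ ∧ f dt`. -/
def evolΩ₃ (e : Fin 3 → ℝ → (x : G) → TangentSpace (𝓡 3) x →L[ℝ] ℝ) (f : ℝ → ℝ) (p : G × ℝ) :
    TangentSpace ((𝓡 3).prod 𝓘(ℝ, ℝ)) p [⋀^Fin 2]→L[ℝ] ℝ :=
  wedge (spatial (e 1) p) (spatial (e 2) p) + wedge (spatial (e 0) p) (temporal f p)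

end Evolution

end

open Set Bundle
open scoped Manifold ContDiff Topology

noncomputable section

/-! ### Exterior calculus on a cylinder `U ×ˢ T` in `E × ℝ` -/

section Cylinder

variable {E : Type*} [NormedAddCommGroup E] [NormedSpace ℝ E]

/-! Up to an overall sign each of the three forms is `Θ = β + γ ∧ dt`, with `β = eⁱ ∧ eʲ` and `γ = c
f eᵏ` for a constant `c = ±1`. Its exterior derivative splits into a spatial part, the derivative of
`β` on slices, and a contraction with `∂/∂t`, equal to `∂β/∂t + dγ`. Hence `Θ` is closed iff `eⁱ ∧
eʲ` is closed on `G` at every time and `∂(eⁱ ∧ eʲ)/∂t = -c f deᵏ`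
(`extDerivWithin_cylinderForm_eq_zero_iff`, `extDerivOn_evolForm_eq_zero_iff`).

Closedness at a single time suffices: once the contraction of `dΘ` with `∂/∂t` vanishes throughout a
chart cylinder, `d²Θ = 0` says that the spatial part of `dΘ` has zero time derivative, so on an
interval it is constant (`extDerivWithin_spatial_const`, `closedOn_evolForm`). This uses the
evolution equation at all points of one chart, hence the independence of `d` from the chart
(`extDerivOn_univ_apply_of_mem_source`).

The algebraic half is fibrewise. The coframe `(e¹, e², e³, f dt)` identifies each tangent space with
`ℝ⁴`, and pulling back a constant model structure gives existence, the metric and its signature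
(`AlmostHyperParahermitian.ofCoframe`, `signature_of_split_form`). Uniqueness holds because `P₁` and
`P₂` are recovered by comparing `Ω₃` and `Ω₂` with the nondegenerate `Ω₁`; then `J = -P₁ P₂` and `g
= -Ω₁(·, J·)` (`eq_of_fundamentalForms_eq`). By uniqueness the computations on the model apply to
every structure with these forms. -/

theorem norm_wedge_le (α β : E →L[ℝ] ℝ) : ‖wedge α β‖ ≤ 2 * ‖α‖ * ‖β‖ := by
  refine ContinuousAlternatingMap.opNorm_le_bound _ (by positivity) fun v => ?_
  have h₁ := α.le_opNorm (v 0)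
  have h₂ := α.le_opNorm (v 1)
  have h₃ := β.le_opNorm (v 0)
  have h₄ := β.le_opNorm (v 1)
  rw [wedge_apply, Fin.prod_univ_two]
  calc ‖α (v 0) * β (v 1) - α (v 1) * β (v 0)‖
      ≤ ‖α (v 0)‖ * ‖β (v 1)‖ + ‖α (v 1)‖ * ‖β (v 0)‖ := by
        simpa only [norm_mul] using norm_sub_le (α (v 0) * β (v 1)) (α (v 1) * β (v 0))
    _ ≤ (‖α‖ * ‖v 0‖) * (‖β‖ * ‖v 1‖) + (‖α‖ * ‖v 1‖) * (‖β‖ * ‖v 0‖) := by gcongr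
    _ = 2 * ‖α‖ * ‖β‖ * (‖v 0‖ * ‖v 1‖) := by ring

theorem isBoundedBilinearMap_wedge :
    IsBoundedBilinearMap ℝ fun p : (E →L[ℝ] ℝ) × (E →L[ℝ] ℝ) => wedge p.1 p.2 where
  add_left _ _ _ := by ext; simp; ring
  smul_left _ _ _ := by ext; simp; ring
  add_right _ _ _ := by ext; simp; ring
  smul_right _ _ _ := by ext; simp; ring
  bound := ⟨2, two_pos, norm_wedge_le⟩

theorem ContDiffOn.wedge {F : Type*} [NormedAddCommGroup F] [NormedSpace ℝ F] {n : WithTop ℕ∞}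
    {s : Set F} {α β : F → E →L[ℝ] ℝ} (hα : ContDiffOn ℝ n α s) (hβ : ContDiffOn ℝ n β s) :
    ContDiffOn ℝ n (fun p => wedge (α p) (β p)) s :=
  (isBoundedBilinearMap_wedge (E := E)).contDiff.comp_contDiffOn (hα.prodMk hβ)

/-- The 2-form `β + γ ∧ dt` on `E × ℝ`, where `β` and `γ` are families of forms on `E`. -/
def cylinderForm (β : E × ℝ → E [⋀^Fin 2]→L[ℝ] ℝ) (γ : E × ℝ → E →L[ℝ] ℝ) (p : E × ℝ) :
    (E × ℝ) [⋀^Fin 2]→L[ℝ] ℝ :=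
  (β p).compContinuousLinearMap (ContinuousLinearMap.fst ℝ E ℝ) +
    wedge ((γ p).comp (ContinuousLinearMap.fst ℝ E ℝ)) (ContinuousLinearMap.snd ℝ E ℝ)

theorem cylinderForm_apply (β : E × ℝ → E [⋀^Fin 2]→L[ℝ] ℝ) (γ : E × ℝ → E →L[ℝ] ℝ) (p : E × ℝ)
    (v : Fin 2 → E × ℝ) :
    cylinderForm β γ p v = β p (fun i => (v i).1) +
      (γ p (v 0).1 * (v 1).2 - γ p (v 1).1 * (v 0).2) := rfl

theorem ContDiffOn.cylinderForm {n : WithTop ℕ∞} {s : Set (E × ℝ)}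
    {β : E × ℝ → E [⋀^Fin 2]→L[ℝ] ℝ} {γ : E × ℝ → E →L[ℝ] ℝ}
    (hβ : ContDiffOn ℝ n β s) (hγ : ContDiffOn ℝ n γ s) :
    ContDiffOn ℝ n (cylinderForm β γ) s := by
  refine ContDiffOn.add ?_ (ContDiffOn.wedge ?_ contDiffOn_const)
  · exact (ContinuousAlternatingMap.compContinuousLinearMapCLM
      (ContinuousLinearMap.fst ℝ E ℝ)).contDiff.comp_contDiffOn hβ
  · exact hγ.clm_comp contDiffOn_const

variable {U : Set E} {T : Set ℝ} {y : E} {t : ℝ}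

/-- Openness of `U` turns the spatial derivative into an ordinary one; in the time direction only
derivatives within `T` make sense, since `T` may contain its endpoints. -/
theorem fderivWithin_prod_apply_left {c : E × ℝ → ℝ} (hU : IsOpen U) (hy : y ∈ U) (ht : t ∈ T)
    (hc : DifferentiableWithinAt ℝ c (U ×ˢ T) (y, t)) (a : E) :
    fderivWithin ℝ c (U ×ˢ T) (y, t) (a, 0) = fderiv ℝ (fun z => c (z, t)) y a := by
  have h : HasFDerivAt (fun z : E => (z, t)) (ContinuousLinearMap.inl ℝ E ℝ) y :=
    hasFDerivAt_prodMk_left y t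
  have := (hc.hasFDerivWithinAt.comp y h.hasFDerivWithinAt
    (fun _ hz => mk_mem_prod hz ht : MapsTo _ U _)).hasFDerivAt (hU.mem_nhds hy)
  rw [show (fun z => c (z, t)) = c ∘ fun z => (z, t) from rfl, this.fderiv]
  simp

theorem ContDiffOn.differentiableAt_slice {F : Type*} [NormedAddCommGroup F] [NormedSpace ℝ F]
    {φ : E × ℝ → F} (hφ : ContDiffOn ℝ 1 φ (U ×ˢ T)) (hU : IsOpen U) (hy : y ∈ U) (ht : t ∈ T) :
    DifferentiableAt ℝ (fun z => φ (z, t)) y :=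
  ((hφ.comp (contDiffOn_id.prodMk contDiffOn_const)
    (fun _ hz => mk_mem_prod hz ht : MapsTo _ U _)).differentiableOn one_ne_zero y
      hy).differentiableAt (hU.mem_nhds hy)

theorem hasDerivWithinAt_of_prod {c : E × ℝ → ℝ} (hy : y ∈ U)
    (hc : DifferentiableWithinAt ℝ c (U ×ˢ T) (y, t)) :
    HasDerivWithinAt (fun r => c (y, r)) (fderivWithin ℝ c (U ×ˢ T) (y, t) (0, 1)) T t := by
  have h : HasFDerivAt (fun r : ℝ => (y, r)) (ContinuousLinearMap.inr ℝ E ℝ) t :=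
    hasFDerivAt_prodMk_right y t
  have := (hc.hasFDerivWithinAt.comp t h.hasFDerivWithinAt
    (fun _ hz => mk_mem_prod hy hz : MapsTo _ T _)).hasDerivWithinAt
  simpa using! this

theorem DifferentiableWithinAt.alternating_apply {F : Type*} [NormedAddCommGroup F]
    [NormedSpace ℝ F] {k : ℕ} {θ : F → E [⋀^Fin k]→L[ℝ] ℝ} {s : Set F} {x : F}
    (h : DifferentiableWithinAt ℝ θ s x) (v : Fin k → E) :
    DifferentiableWithinAt ℝ (fun q => θ q v) s x :=
  (ContinuousAlternatingMap.apply ℝ E ℝ v).differentiableAt.comp_differentiableWithinAt x h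

/-- On spatial vectors the alternating sum for `dΘ` differentiates only in spatial directions, so it
sees nothing but the slice at time `t`. -/
theorem extDerivWithin_apply_spatial (hU : IsOpen U) (hT : UniqueDiffOn ℝ T) {k : ℕ}
    {Θ : E × ℝ → (E × ℝ) [⋀^Fin k]→L[ℝ] ℝ}
    {β : E → E [⋀^Fin k]→L[ℝ] ℝ} (hy : y ∈ U) (ht : t ∈ T)
    (hΘ : DifferentiableWithinAt ℝ Θ (U ×ˢ T) (y, t)) (hβ : DifferentiableAt ℝ β y)
    (h : ∀ z v, Θ (z, t) (fun i => (v i, 0)) = β z v) (a : Fin (k + 1) → E) :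
    extDerivWithin Θ (U ×ˢ T) (y, t) (fun i => (a i, 0)) = extDeriv β y a := by
  rw [extDerivWithin_apply hΘ (hU.uniqueDiffOn.prod hT _ ⟨hy, ht⟩), extDeriv_apply hβ]
  refine Finset.sum_congr rfl fun i _ => ?_
  rw [fderivWithin_prod_apply_left hU hy ht (hΘ.alternating_apply _)]
  congr 3
  funext z
  exact h z _

/-- The exterior derivative of `β + γ ∧ dt`, contracted with `∂/∂t`. -/
theorem extDerivWithin_cylinderForm_apply_dt (hU : IsOpen U) (hT : UniqueDiffOn ℝ T)
    {β : E × ℝ → E [⋀^Fin 2]→L[ℝ] ℝ} {γ : E × ℝ → E →L[ℝ] ℝ} (hy : y ∈ U) (ht : t ∈ T)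
    (hΘ : DifferentiableWithinAt ℝ (cylinderForm β γ) (U ×ˢ T) (y, t))
    (hβ : DifferentiableWithinAt ℝ β (U ×ˢ T) (y, t))
    (hγ : DifferentiableAt ℝ (fun z => γ (z, t)) y) (a : Fin 2 → E) :
    extDerivWithin (cylinderForm β γ) (U ×ˢ T) (y, t) ![(0, 1), (a 0, 0), (a 1, 0)] =
      derivWithin (fun r => β (y, r) a) T t +
      extDeriv (fun z => ContinuousAlternatingMap.ofSubsingleton ℝ E ℝ (0 : Fin 1) (γ (z, t)))
        y a := by
  have hγ' : DifferentiableAt ℝ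
      (fun z => ContinuousAlternatingMap.ofSubsingleton ℝ E ℝ (0 : Fin 1) (γ (z, t))) y :=
    (ContinuousAlternatingMap.ofSubsingletonLIE (𝕜 := ℝ) (E := E) (F := ℝ) (0 : Fin 1)).differentiable.differentiableAt.comp y hγ
  rw [extDerivWithin_apply hΘ (hU.uniqueDiffOn.prod hT _ ⟨hy, ht⟩), extDeriv_apply hγ']
  have h₀ : (fun q => cylinderForm β γ q
      (Fin.removeNth 0 ![((0 : E), (1 : ℝ)), (a 0, 0), (a 1, 0)])) = fun q => β q a := by
    funext q
    rw [cylinderForm_apply]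
    have : (fun i => (Fin.removeNth 0 ![((0 : E), (1 : ℝ)), (a 0, 0), (a 1, 0)] i).1) = a := by
      funext i; fin_cases i <;> rfl
    rw [this]
    simp [Fin.removeNth]
  -- Removing slot 1 (or 2, below) keeps `∂/∂t`, whose spatial component is zero: `β` drops out, and
  -- only `γ ∧ dt` contributes, with a minus sign because `∂/∂t` comes first.
  have h₁ : (fun z => cylinderForm β γ (z, t)
      (Fin.removeNth 1 ![((0 : E), (1 : ℝ)), (a 0, 0), (a 1, 0)])) = fun z => -γ (z, t) (a 1) := by
    funext z
    rw [cylinderForm_apply, ContinuousAlternatingMap.map_coord_zero _ (0 : Fin 2) rfl]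
    simp [Fin.removeNth, Fin.succAbove]
  have h₂ : (fun z => cylinderForm β γ (z, t)
      (Fin.removeNth 2 ![((0 : E), (1 : ℝ)), (a 0, 0), (a 1, 0)])) = fun z => -γ (z, t) (a 0) := by
    funext z
    rw [cylinderForm_apply, ContinuousAlternatingMap.map_coord_zero _ (0 : Fin 2) rfl]
    simp [Fin.removeNth, Fin.succAbove]
  have hβa := hβ.alternating_apply a
  rw [Fin.sum_univ_three, Fin.sum_univ_two]
  simp only [Matrix.cons_val_zero, Matrix.cons_val_one, Matrix.cons_val]
  rw [h₀, fderivWithin_prod_apply_left hU hy ht (hΘ.alternating_apply _), h₁,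
    fderivWithin_prod_apply_left hU hy ht (hΘ.alternating_apply _), h₂,
    ← (hasDerivWithinAt_of_prod hy hβa).derivWithin (hT t ht)]
  have h_tail : Fin.tail a 0 = a 1 := rfl
  simp [Fin.removeNth, fderiv_fun_neg, h_tail, add_assoc]

theorem ContinuousAlternatingMap.map_swap_zero_one {V : Type*} [AddCommGroup V] [Module ℝ V]
    [TopologicalSpace V] (θ : V [⋀^Fin 3]→L[ℝ] ℝ) (a b c : V) : θ ![b, a, c] = -θ ![a, b, c] := by
  have h : ![b, a, c] = ![a, b, c] ∘ Equiv.swap (0 : Fin 3) 1 := by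
    funext i; fin_cases i <;> rfl
  rw [h]
  exact θ.toAlternatingMap.map_swap ![a, b, c] (show (0 : Fin 3) ≠ 1 by decide)

theorem ContinuousAlternatingMap.map_swap_zero_two {V : Type*} [AddCommGroup V] [Module ℝ V]
    [TopologicalSpace V] (θ : V [⋀^Fin 3]→L[ℝ] ℝ) (a b c : V) : θ ![c, b, a] = -θ ![a, b, c] := by
  have h : ![c, b, a] = ![a, b, c] ∘ Equiv.swap (0 : Fin 3) 2 := by
    funext i; fin_cases i <;> rfl
  rw [h]
  exact θ.toAlternatingMap.map_swap ![a, b, c] (show (0 : Fin 3) ≠ 2 by decide)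

theorem ContinuousAlternatingMap.map_add_smul_zero {V : Type*} [AddCommGroup V] [Module ℝ V]
    [TopologicalSpace V] {k : ℕ} (θ : V [⋀^Fin (k + 1)]→L[ℝ] ℝ) (a b : V) (r : ℝ) (v : Fin k → V) :
    θ (Matrix.vecCons (a + r • b) v) =
      θ (Matrix.vecCons a v) + r * θ (Matrix.vecCons b v) :=
  (θ.toAlternatingMap.map_vecCons_add v a (r • b)).trans
    (congrArg _ (θ.toAlternatingMap.map_vecCons_smul v r b))

/-- A 3-form on `E × ℝ` vanishes if it vanishes on vectors tangent to `E` and its contraction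
with `∂/∂t` vanishes on vectors tangent to `E`. -/
theorem alternating_ext_of_split {θ : (E × ℝ) [⋀^Fin 3]→L[ℝ] ℝ}
    (h₁ : ∀ a : Fin 3 → E, θ (fun i => (a i, 0)) = 0)
    (h₂ : ∀ a : Fin 2 → E, θ ![(0, 1), (a 0, 0), (a 1, 0)] = 0) : θ = 0 := by
  have h₁' (a b c : E) : θ ![(a, 0), (b, 0), (c, 0)] = 0 := by
    convert h₁ ![a, b, c] using 2
    funext i; fin_cases i <;> rfl
  have h₂' (a b : E) : θ ![(0, 1), (a, 0), (b, 0)] = 0 := h₂ ![a, b]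
  -- Split one argument at a time as `u = (u.1, 0) + u.2 • (0, 1)`, using swaps to bring it to the
  -- front; a repeated `∂/∂t` gives zero by alternation.
  have lin {u b c : E × ℝ} (h : θ ![(u.1, 0), b, c] = 0) (h' : θ ![(0, 1), b, c] = 0) :
      θ ![u, b, c] = 0 := by
    have := θ.map_add_smul_zero (u.1, 0) (0, 1) u.2 ![b, c]
    simpa [h, h'] using this
  have swap {a b c : E × ℝ} (h : θ ![b, a, c] = 0) : θ ![a, b, c] = 0 := by
    rw [θ.map_swap_zero_one, h, neg_zero]
  have swap' {a b c : E × ℝ} (h : θ ![c, b, a] = 0) : θ ![a, b, c] = 0 := by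
    rw [θ.map_swap_zero_two, h, neg_zero]
  have s₁ (a b : E) (w : E × ℝ) : θ ![(a, 0), (b, 0), w] = 0 :=
    swap' (lin (h₁' _ _ _) (h₂' _ _))
  have s₂ (a : E) (w : E × ℝ) : θ ![(0, 1), (a, 0), w] = 0 :=
    swap' (lin (swap' (h₂' _ _)) (θ.map_eq_zero_of_eq _ (i := 0) (j := 2) rfl (by decide)))
  have s₃ (u w : E × ℝ) : θ ![(0, 1), u, w] = 0 :=
    swap (lin (swap (s₂ _ _)) (θ.map_eq_zero_of_eq _ (i := 0) (j := 1) rfl (by decide)))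
  ext v
  have hv : v = ![v 0, v 1, v 2] := by funext i; fin_cases i <;> rfl
  rw [hv]
  exact lin (swap (lin (s₁ _ _ _) (s₃ _ _))) (s₃ _ _)

theorem extDerivWithin_cylinderForm_eq_zero_iff (hU : IsOpen U) (hT : UniqueDiffOn ℝ T)
    {β : E × ℝ → E [⋀^Fin 2]→L[ℝ] ℝ} {γ : E × ℝ → E →L[ℝ] ℝ} (hy : y ∈ U) (ht : t ∈ T)
    (hβ : ContDiffOn ℝ 1 β (U ×ˢ T)) (hγ : ContDiffOn ℝ 1 γ (U ×ˢ T)) :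
    extDerivWithin (cylinderForm β γ) (U ×ˢ T) (y, t) = 0 ↔
      extDeriv (fun z => β (z, t)) y = 0 ∧
      ∀ a : Fin 2 → E, HasDerivWithinAt (fun r => β (y, r) a)
        (-extDeriv (fun z => ContinuousAlternatingMap.ofSubsingleton ℝ E ℝ (0 : Fin 1) (γ (z, t)))
          y a) T t := by
  have hp : (y, t) ∈ U ×ˢ T := ⟨hy, ht⟩
  have hΘ := (hβ.cylinderForm hγ).differentiableOn one_ne_zero _ hp
  have hβ' := hβ.differentiableOn one_ne_zero _ hp
  have key₁ (a : Fin 3 → E) := extDerivWithin_apply_spatial hU hT hy ht hΘ (hβ.differentiableAt_slice hU hy ht)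
    (fun z v => by simp [cylinderForm_apply]) a
  have key₂ := extDerivWithin_cylinderForm_apply_dt hU hT hy ht hΘ hβ' (hγ.differentiableAt_slice hU hy ht)
  have hd (a : Fin 2 → E) : HasDerivWithinAt (fun r => β (y, r) a)
      (derivWithin (fun r => β (y, r) a) T t) T t :=
    (hasDerivWithinAt_of_prod hy (hβ'.alternating_apply a)).differentiableWithinAt.hasDerivWithinAt
  constructor
  · intro h
    rw [h] at key₁ key₂
    refine ⟨by ext a; exact (key₁ a).symm, fun a => ?_⟩
    rw [← eq_neg_of_add_eq_zero_left (key₂ a).symm]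
    exact hd a
  · rintro ⟨h₁, h₂⟩
    refine alternating_ext_of_split (fun a => ?_) fun a => ?_
    · rw [key₁, h₁]; rfl
    · rw [key₂, (h₂ a).derivWithin (hT t ht)]; simp

/-- If `∂/∂t ⌟ dΘ = 0`, the spatial part of `dΘ` does not depend on `t`, because `d²Θ = 0`. -/
theorem extDerivWithin_spatial_const (hU : IsOpen U) (hT : Convex ℝ T)
    (hT' : (interior T).Nonempty) {Θ : E × ℝ → (E × ℝ) [⋀^Fin 2]→L[ℝ] ℝ}
    (hΘ : ContDiffOn ℝ 2 Θ (U ×ˢ T))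
    (h : ∀ p ∈ U ×ˢ T, ∀ a : Fin 2 → E,
      extDerivWithin Θ (U ×ˢ T) p ![(0, 1), (a 0, 0), (a 1, 0)] = 0)
    (hy : y ∈ U) {t t' : ℝ} (ht : t ∈ T) (ht' : t' ∈ T) (a : Fin 3 → E) :
    extDerivWithin Θ (U ×ˢ T) (y, t) (fun i => (a i, 0)) =
      extDerivWithin Θ (U ×ˢ T) (y, t') (fun i => (a i, 0)) := by
  have hTu := uniqueDiffOn_convex hT hT'
  have hS : UniqueDiffOn ℝ (U ×ˢ T) := hU.uniqueDiffOn.prod hTu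
  have hD (r) (hr : r ∈ T) :
      DifferentiableWithinAt ℝ (extDerivWithin Θ (U ×ˢ T)) (U ×ˢ T) (y, r) := by
    have := (hΘ.contDiffWithinAt (mk_mem_prod hy hr)).fderivWithin_right (m := 1) hS
      (by norm_num) (mk_mem_prod hy hr)
    exact (ContinuousAlternatingMap.alternatizeUncurryFinCLM ℝ (E × ℝ)
      ℝ).differentiableAt.comp_differentiableWithinAt _ (this.differentiableWithinAt one_ne_zero)
  have hd (r) (hr : r ∈ T) := hasDerivWithinAt_of_prod hy
    ((hD r hr).alternating_apply (fun i => (a i, (0 : ℝ))))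
  refine hT.is_const_of_fderivWithin_eq_zero (𝕜 := ℝ)
    (f := fun r => extDerivWithin Θ (U ×ˢ T) (y, r) (fun i => (a i, 0)))
    (fun r hr => (hd r hr).differentiableWithinAt) (fun r hr => ?_) ht ht'
  have hz : fderivWithin ℝ (fun q => extDerivWithin Θ (U ×ˢ T) q (fun i => (a i, 0)))
      (U ×ˢ T) (y, r) (0, 1) = 0 := by
    -- `d² = 0` rests on symmetry of second derivatives, which at an endpoint of `T` is inherited
    -- from interior points by taking limits.
    have hcl : (y, r) ∈ closure (interior (U ×ˢ T)) := by
      rw [interior_prod_eq, closure_prod_eq, hU.interior_eq]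
      exact ⟨subset_closure hy, hT.closure_interior_eq_closure_of_nonempty_interior hT' ▸
        subset_closure hr⟩
    have hdd := extDerivWithin_extDerivWithin_apply (hΘ.contDiffWithinAt (mk_mem_prod hy hr))
      (by simp) hS hcl (mk_mem_prod hy hr)
    have := congrArg (fun θ => θ ![((0 : E), (1 : ℝ)), (a 0, 0), (a 1, 0), (a 2, 0)]) hdd
    rw [extDerivWithin_apply (hD r hr) (hS _ (mk_mem_prod hy hr))] at this
    -- In `d(dΘ)(∂/∂t, a₀, a₁, a₂)` three of the four terms differentiate a contraction of `dΘ` with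
    -- `∂/∂t`, zero by `h`; the surviving term is the time derivative sought.
    have hvan (b : Fin 2 → E) (w : E × ℝ) : fderivWithin ℝ (fun q => extDerivWithin Θ (U ×ˢ T) q
        ![(0, 1), (b 0, 0), (b 1, 0)]) (U ×ˢ T) (y, r) w = 0 := by
      rw [fderivWithin_congr (f := fun _ => (0 : ℝ)) (fun q hq => h q hq b)
        (h _ (mk_mem_prod hy hr) b)]
      simp
    have r₀ : Fin.removeNth 0 ![((0 : E), (1 : ℝ)), (a 0, 0), (a 1, 0), (a 2, 0)] =
        fun i => (a i, 0) := by funext i; fin_cases i <;> rfl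
    have r₁ : Fin.removeNth 1 ![((0 : E), (1 : ℝ)), (a 0, 0), (a 1, 0), (a 2, 0)] =
        ![(0, 1), (![a 1, a 2] 0, 0), (![a 1, a 2] 1, 0)] := by funext i; fin_cases i <;> rfl
    have r₂ : Fin.removeNth 2 ![((0 : E), (1 : ℝ)), (a 0, 0), (a 1, 0), (a 2, 0)] =
        ![(0, 1), (![a 0, a 2] 0, 0), (![a 0, a 2] 1, 0)] := by funext i; fin_cases i <;> rfl
    have r₃ : Fin.removeNth 3 ![((0 : E), (1 : ℝ)), (a 0, 0), (a 1, 0), (a 2, 0)] =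
        ![(0, 1), (![a 0, a 1] 0, 0), (![a 0, a 1] 1, 0)] := by funext i; fin_cases i <;> rfl
    rw [Fin.sum_univ_four, r₀, r₁, r₂, r₃, hvan, hvan, hvan] at this
    simpa using this
  have := hd r hr
  rw [hz] at this
  rw [this.hasFDerivWithinAt.fderivWithin (hTu r hr)]
  ext
  simp

end Cylinder

/-! ### Coframes and the product structure in charts -/

section Chart

variable {G : Type*} [TopologicalSpace G] [ChartedSpace (EuclideanSpace ℝ (Fin 3)) G]

/-- A field of covectors on `G`, read in the chart at `x₀`. -/
def covectorInChart (x₀ : G) (α : (x : G) → TangentSpace (𝓡 3) x →L[ℝ] ℝ)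
    (y : EuclideanSpace ℝ (Fin 3)) : EuclideanSpace ℝ (Fin 3) →L[ℝ] ℝ :=
  (α ((extChartAt (𝓡 3) x₀).symm y)).comp
    (mfderivWithin 𝓘(ℝ, EuclideanSpace ℝ (Fin 3)) (𝓡 3) (extChartAt (𝓡 3) x₀).symm
      (range (𝓡 3)) y)

variable [IsManifold (𝓡 3) ∞ G]

theorem IsSmoothCoframe.contDiffOn_covectorInChart {T : Set ℝ}
    {e : Fin 3 → ℝ → (x : G) → TangentSpace (𝓡 3) x →L[ℝ] ℝ} (he : IsSmoothCoframe T e)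
    (i : Fin 3) (x₀ : G) :
    ContDiffOn ℝ ∞ (fun p : EuclideanSpace ℝ (Fin 3) × ℝ => covectorInChart x₀ (e i p.2) p.1)
      ((extChartAt (𝓡 3) x₀).target ×ˢ T) := by
  have h₁ : ContMDiffOn (𝓘(ℝ, EuclideanSpace ℝ (Fin 3)).prod 𝓘(ℝ, ℝ)) ((𝓡 3).prod 𝓘(ℝ, ℝ)) ∞
      (fun p : EuclideanSpace ℝ (Fin 3) × ℝ => ((extChartAt (𝓡 3) x₀).symm p.1, p.2))
      ((extChartAt (𝓡 3) x₀).target ×ˢ T) :=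
    ((contMDiffOn_extChartAt_symm x₀).comp contMDiffOn_fst fun p hp => hp.1).prodMk contMDiffOn_snd
  have h₂ := (he.smooth i).comp h₁ fun p hp => ⟨mem_univ _, hp.2⟩
  have h₃ := ((trivializationAt (EuclideanSpace ℝ (Fin 3) →L[ℝ] ℝ)
    (fun x : G => TangentSpace (𝓡 3) x →L[ℝ] ℝ) x₀).contMDiffOn_iff (fun p hp => by
      rw [hom_trivializationAt_source]
      have := (extChartAt (𝓡 3) x₀).map_target hp.1
      rw [extChartAt_source] at this
      exact ⟨this, mem_univ _⟩)).1 h₂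
  have h₄ := h₃.2
  rw [← modelWithCornersSelf_prod, chartedSpaceSelf_prod] at h₄
  refine h₄.contDiffOn.congr fun p hp => ?_
  have hs := (extChartAt (𝓡 3) x₀).map_target hp.1
  rw [extChartAt_source] at hs
  -- The hom-bundle trivialization precomposes with the inverse of the tangent trivialization, which
  -- is the derivative of the inverse chart: exactly the map in `covectorInChart`.
  change _ = (Trivialization.continuousLinearMapAt ℝ
    (trivializationAt ℝ (Bundle.Trivial G ℝ) x₀) ((extChartAt (𝓡 3) x₀).symm p.1)).comp
    ((e i p.2 ((extChartAt (𝓡 3) x₀).symm p.1)).comp (Trivialization.symmL ℝ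
      (trivializationAt (EuclideanSpace ℝ (Fin 3)) (TangentSpace (𝓡 3)) x₀)
        ((extChartAt (𝓡 3) x₀).symm p.1)))
  rw [TangentBundle.symmL_trivializationAt hs, (extChartAt (𝓡 3) x₀).right_inv hp.1]
  ext v
  simp [covectorInChart]

theorem mfderivWithin_extChartAt_prod_symm (x₀ : G) (t₀ : ℝ)
    {q : EuclideanSpace ℝ (Fin 3) × ℝ} (hq : q.1 ∈ (extChartAt (𝓡 3) x₀).target) :
    mfderivWithin 𝓘(ℝ, EuclideanSpace ℝ (Fin 3) × ℝ) ((𝓡 3).prod 𝓘(ℝ, ℝ))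
      (extChartAt ((𝓡 3).prod 𝓘(ℝ, ℝ)) (x₀, t₀)).symm (range ((𝓡 3).prod 𝓘(ℝ, ℝ))) q =
    ((mfderivWithin 𝓘(ℝ, EuclideanSpace ℝ (Fin 3)) (𝓡 3) (extChartAt (𝓡 3) x₀).symm
      (range (𝓡 3)) q.1).comp (ContinuousLinearMap.fst ℝ (EuclideanSpace ℝ (Fin 3)) ℝ)).prod
      (ContinuousLinearMap.snd ℝ (EuclideanSpace ℝ (Fin 3)) ℝ) := by
  have h₁ := (mdifferentiableWithinAt_extChartAt_symm (I := 𝓡 3) hq).hasMFDerivWithinAt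
  have h₂ : HasMFDerivWithinAt 𝓘(ℝ, EuclideanSpace ℝ (Fin 3) × ℝ)
      𝓘(ℝ, EuclideanSpace ℝ (Fin 3)) Prod.fst (range ((𝓡 3).prod 𝓘(ℝ, ℝ))) q
      (ContinuousLinearMap.fst ℝ (EuclideanSpace ℝ (Fin 3)) ℝ) :=
    (ContinuousLinearMap.fst ℝ (EuclideanSpace ℝ (Fin 3)) ℝ).hasMFDerivAt.hasMFDerivWithinAt
  have h₃ : HasMFDerivWithinAt 𝓘(ℝ, EuclideanSpace ℝ (Fin 3) × ℝ)
      𝓘(ℝ, ℝ) Prod.snd (range ((𝓡 3).prod 𝓘(ℝ, ℝ))) q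
      (ContinuousLinearMap.snd ℝ (EuclideanSpace ℝ (Fin 3)) ℝ) :=
    (ContinuousLinearMap.snd ℝ (EuclideanSpace ℝ (Fin 3)) ℝ).hasMFDerivAt.hasMFDerivWithinAt
  have h₄ := (h₁.comp q h₂ (by intro z _; simp)).prodMk h₃
  have : UniqueMDiffWithinAt 𝓘(ℝ, EuclideanSpace ℝ (Fin 3) × ℝ)
      (range ((𝓡 3).prod 𝓘(ℝ, ℝ))) q := by
    rw [ModelWithCorners.range_eq_univ]; exact uniqueMDiffWithinAt_univ _
  exact h₄.mfderivWithin this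

theorem spatial_comp_mfderivWithin_extChartAt_symm (x₀ : G) (t₀ : ℝ)
    (α : ℝ → (x : G) → TangentSpace (𝓡 3) x →L[ℝ] ℝ)
    {q : EuclideanSpace ℝ (Fin 3) × ℝ} (hq : q.1 ∈ (extChartAt (𝓡 3) x₀).target) :
    (spatial α ((extChartAt ((𝓡 3).prod 𝓘(ℝ, ℝ)) (x₀, t₀)).symm q)).comp
      (mfderivWithin 𝓘(ℝ, EuclideanSpace ℝ (Fin 3) × ℝ) ((𝓡 3).prod 𝓘(ℝ, ℝ))
      (extChartAt ((𝓡 3).prod 𝓘(ℝ, ℝ)) (x₀, t₀)).symm (range ((𝓡 3).prod 𝓘(ℝ, ℝ))) q) =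
    (covectorInChart x₀ (α q.2) q.1).comp
      (ContinuousLinearMap.fst ℝ (EuclideanSpace ℝ (Fin 3)) ℝ) := by
  rw [mfderivWithin_extChartAt_prod_symm x₀ t₀ hq, spatial, mfderiv_fst]
  rfl

theorem temporal_comp_mfderivWithin_extChartAt_symm (x₀ : G) (t₀ : ℝ) (f : ℝ → ℝ)
    {q : EuclideanSpace ℝ (Fin 3) × ℝ} (hq : q.1 ∈ (extChartAt (𝓡 3) x₀).target) :
    (temporal f ((extChartAt ((𝓡 3).prod 𝓘(ℝ, ℝ)) (x₀, t₀)).symm q)).comp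
      (mfderivWithin 𝓘(ℝ, EuclideanSpace ℝ (Fin 3) × ℝ) ((𝓡 3).prod 𝓘(ℝ, ℝ))
      (extChartAt ((𝓡 3).prod 𝓘(ℝ, ℝ)) (x₀, t₀)).symm (range ((𝓡 3).prod 𝓘(ℝ, ℝ))) q) =
    f q.2 • ContinuousLinearMap.snd ℝ (EuclideanSpace ℝ (Fin 3)) ℝ := by
  rw [mfderivWithin_extChartAt_prod_symm x₀ t₀ hq, temporal, mfderiv_snd]
  rfl

end Chart

/-! ### The exterior derivative on a manifold and its independence of the chart -/

section ExtDerivOn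

variable {E : Type*} [NormedAddCommGroup E] [NormedSpace ℝ E]
  {H : Type*} [TopologicalSpace H] (I : ModelWithCorners ℝ E H)
  {M : Type*} [TopologicalSpace M] [ChartedSpace H M]

theorem extDerivOn_congr {k : ℕ} {s : Set M}
    {θ θ' : (x : M) → TangentSpace I x [⋀^Fin k]→L[ℝ] ℝ} (h : ∀ x ∈ s, θ x = θ' x) {x : M}
    (hx : x ∈ s) : extDerivOn I s θ x = extDerivOn I s θ' x := by
  have hmem : extChartAt I x x ∈ (extChartAt I x).symm ⁻¹' s ∩ range I :=
    ⟨by simpa using hx, mem_range_self _⟩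
  unfold extDerivOn
  rw [extDerivWithin_congr' (fun y hy => ?_) hmem]
  unfold formInChart
  rw [h _ hy.1]

theorem ClosedOn.congr {k : ℕ} {s : Set M}
    {θ θ' : (x : M) → TangentSpace I x [⋀^Fin k]→L[ℝ] ℝ} (h : ∀ x ∈ s, θ x = θ' x) :
    ClosedOn I s θ ↔ ClosedOn I s θ' :=
  forall₂_congr fun _ hx => by rw [extDerivOn_congr I h hx]

theorem formInChart_extChartAt {k : ℕ} (θ : (x : M) → TangentSpace I x [⋀^Fin k]→L[ℝ] ℝ)
    {x₀ z : M} (hz : z ∈ (extChartAt I x₀).source) (v : Fin k → E) :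
    formInChart I θ x₀ (extChartAt I x₀ z) v = θ z (fun i =>
      mfderivWithin 𝓘(ℝ, E) I (extChartAt I x₀).symm (range I) (extChartAt I x₀ z) (v i)) := by
  -- The vectors are typed in the fixed model space `E`, so that `left_inv` can be used although `θ
  -- z'` and `θ z` live on different tangent spaces.
  have key (z' : M) (h : z' = z) (w : Fin k → E) : θ z' w = θ z w := by
    rw [h]
  exact key _ ((extChartAt I x₀).left_inv hz) _

variable [IsManifold I 1 M]

theorem extDerivOn_eq {k : ℕ} (s : Set M)
    (θ : (x : M) → TangentSpace I x [⋀^Fin k]→L[ℝ] ℝ) (x : M) :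
    extDerivOn I s θ x = extDerivWithin (formInChart I θ x)
      ((extChartAt I x).symm ⁻¹' s ∩ range I) (extChartAt I x x) := by
  unfold extDerivOn
  rw [mfderiv_extChartAt_self]
  rfl

theorem formInChart_self {k : ℕ} (θ : (x : M) → TangentSpace I x [⋀^Fin k]→L[ℝ] ℝ) (x : M) :
    formInChart I θ x (extChartAt I x x) = θ x := by
  refine ContinuousAlternatingMap.ext fun v => ?_
  rw [formInChart_extChartAt I θ (mem_extChartAt_source x), mfderivWithin_range_extChartAt_symm]
  rfl

/-- Needed because `evolΩ₁` is the negative of a form of the common shape `evolForm`. -/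
theorem ClosedOn.neg_iff {k : ℕ} {s : Set M}
    (hs : ∀ x ∈ s, UniqueDiffWithinAt ℝ ((extChartAt I x).symm ⁻¹' s ∩ range I) (extChartAt I x x))
    {θ : (x : M) → TangentSpace I x [⋀^Fin k]→L[ℝ] ℝ} :
    ClosedOn I s (fun x => -θ x) ↔ ClosedOn I s θ := by
  refine forall₂_congr fun x hx => ?_
  rw [extDerivOn_eq, extDerivOn_eq]
  have : formInChart I (fun x => -θ x) x = (-1 : ℝ) • formInChart I θ x := by
    funext y; exact (neg_one_smul ℝ (formInChart I θ x y)).symm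
  rw [this, extDerivWithin_smul _ _ (hs x hx), neg_one_smul]
  exact neg_eq_zero

/-- The exterior derivative may be computed in any chart. -/
theorem extDerivOn_univ_apply_of_mem_source [IsManifold I ∞ M] [I.Boundaryless] {k : ℕ}
    (θ : (x : M) → TangentSpace I x [⋀^Fin k]→L[ℝ] ℝ) {x₀ x : M}
    (hx : x ∈ (extChartAt I x₀).source)
    (hθ : DifferentiableAt ℝ (formInChart I θ x₀) (extChartAt I x₀ x)) (v : Fin (k + 1) → E) :
    extDerivOn I univ θ x v = extDeriv (formInChart I θ x₀) (extChartAt I x₀ x)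
      (fun i => mfderiv I 𝓘(ℝ, E) (extChartAt I x₀) x (v i)) := by
  have hsrc : (extChartAt I x).symm ⁻¹' (extChartAt I x₀).source ∈ 𝓝 (extChartAt I x x) :=
    (continuousAt_extChartAt_symm x).preimage_mem_nhds
      ((isOpen_extChartAt_source x₀).mem_nhds (by simpa using hx))
  rw [extDerivOn_eq, preimage_univ, I.range_eq_univ, univ_inter, extDerivWithin_univ]
  set ψ : E → E := extChartAt I x₀ ∘ (extChartAt I x).symm with hψ
  have hψx : ψ (extChartAt I x x) = extChartAt I x₀ x := by
    rw [hψ, Function.comp_apply, extChartAt_to_inv]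
  have hψ_smooth : ContDiffAt ℝ ∞ ψ (extChartAt I x x) := by
    have h := contDiffWithinAt_ext_coord_change (n := ∞) (I := I) x₀ x
      (y := extChartAt I x x) (by simpa using hx)
    rwa [I.range_eq_univ, contDiffWithinAt_univ] at h
  have hfd {y : E} (hy : y ∈ (extChartAt I x).target)
      (hy' : (extChartAt I x).symm y ∈ (extChartAt I x₀).source) (w : E) :
      fderiv ℝ ψ y w = mfderiv I 𝓘(ℝ, E) (extChartAt I x₀) ((extChartAt I x).symm y)
        (mfderivWithin 𝓘(ℝ, E) I (extChartAt I x).symm (range I) y w) := by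
    rw [extChartAt_source] at hy'
    rw [← mfderiv_eq_fderiv, ← mfderivWithin_univ, ← I.range_eq_univ, hψ,
      mfderiv_comp_mfderivWithin y (mdifferentiableAt_extChartAt hy')
        (mdifferentiableWithinAt_extChartAt_symm hy)
        (I.range_eq_univ ▸ uniqueMDiffWithinAt_univ _)]
    rfl
  -- Near `x` the two chart readings differ by pullback along the transition map `ψ`; the claim is
  -- then naturality of `d` under pullback.
  have hpull : formInChart I θ x =ᶠ[𝓝 (extChartAt I x x)]
      fun y => (formInChart I θ x₀ (ψ y)).compContinuousLinearMap (fderiv ℝ ψ y) := by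
    filter_upwards [hsrc, extChartAt_target_mem_nhds x] with y hy' hy
    refine ContinuousAlternatingMap.ext fun w => ?_
    refine Eq.trans ?_ (formInChart_extChartAt I θ hy' (fun i => fderiv ℝ ψ y (w i))).symm
    refine congrArg (θ ((extChartAt I x).symm y)) (funext fun i => ?_)
    have := mfderivWithin_extChartAt_symm_comp_mfderiv_extChartAt' hy'
    rw [hfd hy hy']
    exact (DFunLike.congr_fun this _).symm
  rw [hpull.extDeriv_eq, extDeriv_pullback (hψx ▸ hθ) hψ_smooth
    (by rw [minSmoothness_of_isRCLikeNormedField]; exact WithTop.coe_le_coe.2 le_top), hψx]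
  refine congrArg (extDeriv (formInChart I θ x₀) (extChartAt I x₀ x)) (funext fun i => ?_)
  refine (hfd (mem_extChartAt_target x) (mem_of_mem_nhds hsrc :) _).trans ?_
  rw [mfderivWithin_range_extChartAt_symm, extChartAt_to_inv]
  rfl

end ExtDerivOn

/-! ### Closedness of `eⁱ ∧ eʲ + c eᵏ ∧ f dt` on `G × T` -/

section Evolution

variable {G : Type*} [TopologicalSpace G] [ChartedSpace (EuclideanSpace ℝ (Fin 3)) G]

/-- `eⁱ ∧ eʲ + c eᵏ ∧ f dt`. -/
def evolForm (e : Fin 3 → ℝ → (x : G) → TangentSpace (𝓡 3) x →L[ℝ] ℝ) (f : ℝ → ℝ) (i j k : Fin 3)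
    (c : ℝ) (p : G × ℝ) : TangentSpace ((𝓡 3).prod 𝓘(ℝ, ℝ)) p [⋀^Fin 2]→L[ℝ] ℝ :=
  wedge (spatial (e i) p) (spatial (e j) p) + c • wedge (spatial (e k) p) (temporal f p)

/-- `eⁱ ∧ eʲ` in the chart at `x₀`, depending on time. -/
def spatialPart (e : Fin 3 → ℝ → (x : G) → TangentSpace (𝓡 3) x →L[ℝ] ℝ) (x₀ : G) (i j : Fin 3)
    (q : EuclideanSpace ℝ (Fin 3) × ℝ) : EuclideanSpace ℝ (Fin 3) [⋀^Fin 2]→L[ℝ] ℝ :=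
  wedge (covectorInChart x₀ (e i q.2) q.1) (covectorInChart x₀ (e j q.2) q.1)

/-- `c f eᵏ` in the chart at `x₀`, depending on time. -/
def temporalPart (e : Fin 3 → ℝ → (x : G) → TangentSpace (𝓡 3) x →L[ℝ] ℝ) (f : ℝ → ℝ) (x₀ : G)
    (k : Fin 3) (c : ℝ) (q : EuclideanSpace ℝ (Fin 3) × ℝ) : EuclideanSpace ℝ (Fin 3) →L[ℝ] ℝ :=
  (c * f q.2) • covectorInChart x₀ (e k q.2) q.1

variable {T : Set ℝ} {e : Fin 3 → ℝ → (x : G) → TangentSpace (𝓡 3) x →L[ℝ] ℝ} {f : ℝ → ℝ}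

/-- The product chart is the identity in the time coordinate, and there is no spatial constraint,
not even outside the chart target. -/
theorem extChartAt_prod_symm_preimage (x₀ : G) (t₀ : ℝ) :
    (extChartAt ((𝓡 3).prod 𝓘(ℝ, ℝ)) (x₀, t₀)).symm ⁻¹' ((univ : Set G) ×ˢ T) ∩
      range ((𝓡 3).prod 𝓘(ℝ, ℝ)) = univ ×ˢ T := by
  rw [ModelWithCorners.range_eq_univ, inter_univ, extChartAt_prod]
  ext q
  simp [chartAt_self_eq]

theorem extDeriv_temporalPart (k : Fin 3) (c : ℝ) (x₀ : G) (t : ℝ)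
    (y : EuclideanSpace ℝ (Fin 3)) :
    extDeriv (fun z => ContinuousAlternatingMap.ofSubsingleton ℝ (EuclideanSpace ℝ (Fin 3)) ℝ
      (0 : Fin 1) (temporalPart e f x₀ k c (z, t))) y =
    (c * f t) • extDeriv (fun z => ContinuousAlternatingMap.ofSubsingleton ℝ
      (EuclideanSpace ℝ (Fin 3)) ℝ (0 : Fin 1) (covectorInChart x₀ (e k t) z)) y :=
  extDeriv_smul (c * f t) fun z => ContinuousAlternatingMap.ofSubsingleton ℝ
    (EuclideanSpace ℝ (Fin 3)) ℝ (0 : Fin 1) (covectorInChart x₀ (e k t) z)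

variable [IsManifold (𝓡 3) ∞ G]

theorem formInChart_evolForm (i j k : Fin 3) (c : ℝ) (x₀ : G) (t₀ : ℝ)
    {q : EuclideanSpace ℝ (Fin 3) × ℝ} (hq : q.1 ∈ (extChartAt (𝓡 3) x₀).target) :
    formInChart ((𝓡 3).prod 𝓘(ℝ, ℝ)) (evolForm e f i j k c) (x₀, t₀) q =
      cylinderForm (spatialPart e x₀ i j) (temporalPart e f x₀ k c) q := by
  have hs (l : Fin 3) (v : EuclideanSpace ℝ (Fin 3) × ℝ) :
      _ = covectorInChart x₀ (e l q.2) q.1 v.1 := DFunLike.congr_fun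
    (spatial_comp_mfderivWithin_extChartAt_symm x₀ t₀ (e l) hq) v
  have ht (v : EuclideanSpace ℝ (Fin 3) × ℝ) : _ = f q.2 * v.2 := DFunLike.congr_fun
    (temporal_comp_mfderivWithin_extChartAt_symm x₀ t₀ f hq) v
  ext v
  refine Eq.trans (congrArg₂ (· + ·) (congrArg₂ (· - ·)
    (congrArg₂ (· * ·) (hs i (v 0)) (hs j (v 1))) (congrArg₂ (· * ·) (hs i (v 1)) (hs j (v 0))))
    (congrArg (c * ·) (congrArg₂ (· - ·)
    (congrArg₂ (· * ·) (hs k (v 0)) (ht (v 1))) (congrArg₂ (· * ·) (hs k (v 1)) (ht (v 0)))))) ?_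
  rw [cylinderForm_apply]
  simp [spatialPart, temporalPart]
  ring

theorem IsSmoothCoframe.contDiffOn_spatialPart (he : IsSmoothCoframe T e) (x₀ : G) (i j : Fin 3) :
    ContDiffOn ℝ ∞ (spatialPart e x₀ i j) ((extChartAt (𝓡 3) x₀).target ×ˢ T) :=
  (he.contDiffOn_covectorInChart i x₀).wedge (he.contDiffOn_covectorInChart j x₀)

theorem IsSmoothCoframe.contDiffOn_temporalPart (he : IsSmoothCoframe T e)
    (hf : ContDiffOn ℝ ∞ f T) (x₀ : G) (k : Fin 3) (c : ℝ) :
    ContDiffOn ℝ ∞ (temporalPart e f x₀ k c) ((extChartAt (𝓡 3) x₀).target ×ˢ T) :=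
  (contDiffOn_const.mul (hf.comp contDiffOn_snd fun _ hq => hq.2)).smul
    (he.contDiffOn_covectorInChart k x₀)

theorem extDerivOn_evolForm (i j k : Fin 3) (c : ℝ) (x₀ : G) {t₀ : ℝ}
    (ht₀ : t₀ ∈ T) :
    extDerivOn ((𝓡 3).prod 𝓘(ℝ, ℝ)) (univ ×ˢ T) (evolForm e f i j k c) (x₀, t₀) =
      extDerivWithin (cylinderForm (spatialPart e x₀ i j) (temporalPart e f x₀ k c))
        ((extChartAt (𝓡 3) x₀).target ×ˢ T) (extChartAt (𝓡 3) x₀ x₀, t₀) := by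
  rw [extDerivOn_eq, extChartAt_prod_symm_preimage]
  have hU : (extChartAt (𝓡 3) x₀).target ×ˢ (univ : Set ℝ) ∈
      𝓝 (extChartAt (𝓡 3) x₀ x₀, t₀) :=
    prod_mem_nhds (extChartAt_target_mem_nhds x₀) Filter.univ_mem
  have hset : (extChartAt (𝓡 3) x₀).target ×ˢ T =
      (univ ×ˢ T) ∩ ((extChartAt (𝓡 3) x₀).target ×ˢ (univ : Set ℝ)) := by
    ext q; simp [and_comm]
  -- The derivative within a set depends only on its germ at the point, so the domain may be cut
  -- down to the chart target, where the cylinder formula holds.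
  have h₁ : extDerivWithin (formInChart ((𝓡 3).prod 𝓘(ℝ, ℝ)) (evolForm e f i j k c) (x₀, t₀))
      (univ ×ˢ T) (extChartAt (𝓡 3) x₀ x₀, t₀) =
      extDerivWithin (formInChart ((𝓡 3).prod 𝓘(ℝ, ℝ)) (evolForm e f i j k c) (x₀, t₀))
      ((extChartAt (𝓡 3) x₀).target ×ˢ T) (extChartAt (𝓡 3) x₀ x₀, t₀) := by
    rw [extDerivWithin, extDerivWithin, hset, fderivWithin_inter hU]
  refine h₁.trans (extDerivWithin_congr' (fun q hq => ?_) ⟨mem_extChartAt_target x₀, ht₀⟩)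
  exact formInChart_evolForm i j k c x₀ t₀ hq.1

theorem IsSmoothCoframe.differentiableAt_covectorInChart (he : IsSmoothCoframe T e) (k : Fin 3)
    (x₀ : G) {t : ℝ} (ht : t ∈ T) {y : EuclideanSpace ℝ (Fin 3)}
    (hy : y ∈ (extChartAt (𝓡 3) x₀).target) :
    DifferentiableAt ℝ (covectorInChart x₀ (e k t)) y :=
  ((he.contDiffOn_covectorInChart k x₀).of_le (by simp)).differentiableAt_slice
    (isOpen_extChartAt_target x₀) hy ht

theorem IsSmoothCoframe.differentiableAt_ofSubsingleton (he : IsSmoothCoframe T e) (k : Fin 3)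
    (x₀ : G) {t : ℝ} (ht : t ∈ T) {y : EuclideanSpace ℝ (Fin 3)}
    (hy : y ∈ (extChartAt (𝓡 3) x₀).target) :
    DifferentiableAt ℝ (fun z => ContinuousAlternatingMap.ofSubsingleton ℝ
      (EuclideanSpace ℝ (Fin 3)) ℝ (0 : Fin 1) (covectorInChart x₀ (e k t) z)) y :=
  (ContinuousAlternatingMap.ofSubsingletonLIE (𝕜 := ℝ) (E := EuclideanSpace ℝ (Fin 3)) (F := ℝ)
    (0 : Fin 1)).differentiable.differentiableAt.comp y
    (he.differentiableAt_covectorInChart k x₀ ht hy)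

theorem IsSmoothCoframe.extDerivCovector_apply (he : IsSmoothCoframe T e) (k : Fin 3)
    (x₀ : G) {t : ℝ} (ht : t ∈ T) {x : G} (hx : x ∈ (extChartAt (𝓡 3) x₀).source)
    (v : Fin 2 → EuclideanSpace ℝ (Fin 3)) :
    extDerivCovector (𝓡 3) (e k t) x v =
      extDeriv (fun z => ContinuousAlternatingMap.ofSubsingleton ℝ (EuclideanSpace ℝ (Fin 3)) ℝ
        (0 : Fin 1) (covectorInChart x₀ (e k t) z)) (extChartAt (𝓡 3) x₀ x)
        (fun i => mfderiv (𝓡 3) 𝓘(ℝ, EuclideanSpace ℝ (Fin 3)) (extChartAt (𝓡 3) x₀) x (v i)) :=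
  extDerivOn_univ_apply_of_mem_source (𝓡 3) (k := 1) (fun x => ContinuousAlternatingMap.ofSubsingleton ℝ
      (TangentSpace (𝓡 3) x) ℝ (0 : Fin 1) (e k t x)) hx
    (he.differentiableAt_ofSubsingleton k x₀ ht ((extChartAt (𝓡 3) x₀).map_source hx)) v

theorem IsSmoothCoframe.extDerivCovector_self (he : IsSmoothCoframe T e) (k : Fin 3)
    (x : G) {t : ℝ} (ht : t ∈ T) :
    extDerivCovector (𝓡 3) (e k t) x =
      extDeriv (fun z => ContinuousAlternatingMap.ofSubsingleton ℝ (EuclideanSpace ℝ (Fin 3)) ℝ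
        (0 : Fin 1) (covectorInChart x (e k t) z)) (extChartAt (𝓡 3) x x) := by
  refine ContinuousAlternatingMap.ext fun v => ?_
  refine (he.extDerivCovector_apply k x ht (mem_extChartAt_source x) v).trans ?_
  rw [mfderiv_extChartAt_self]
  rfl

theorem extDerivOn_coframeWedge (i j : Fin 3) (t : ℝ) (x : G) :
    extDerivOn (𝓡 3) univ (coframeWedge e i j t) x =
      extDeriv (fun z => spatialPart e x i j (z, t)) (extChartAt (𝓡 3) x x) := by
  rw [extDerivOn_eq, preimage_univ, ModelWithCorners.range_eq_univ, univ_inter,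
    extDerivWithin_univ]
  rfl

theorem spatialPart_self (i j : Fin 3) (t : ℝ) (x : G) :
    spatialPart e x i j (extChartAt (𝓡 3) x x, t) = coframeWedge e i j t x :=
  formInChart_self (𝓡 3) (coframeWedge e i j t) x

/-- At its own centre the chart has identity derivative, so the model-space criterion there is
already the intrinsic statement on `T_x G`. -/
theorem extDerivOn_evolForm_eq_zero_iff (hT : UniqueDiffOn ℝ T) (he : IsSmoothCoframe T e)
    (hf : ContDiffOn ℝ ∞ f T) (i j k : Fin 3) (c : ℝ) (x : G) {t : ℝ} (ht : t ∈ T) :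
    extDerivOn ((𝓡 3).prod 𝓘(ℝ, ℝ)) (univ ×ˢ T) (evolForm e f i j k c) (x, t) = 0 ↔
      extDerivOn (𝓡 3) univ (coframeWedge e i j t) x = 0 ∧
      ∀ v : Fin 2 → TangentSpace (𝓡 3) x, HasDerivWithinAt (fun r => coframeWedge e i j r x v)
        (-((c * f t) • extDerivCovector (𝓡 3) (e k t) x v)) T t := by
  rw [extDerivOn_evolForm i j k c x ht, extDerivOn_coframeWedge]
  refine (extDerivWithin_cylinderForm_eq_zero_iff (isOpen_extChartAt_target x) hT
    (mem_extChartAt_target x) ht ((he.contDiffOn_spatialPart x i j).of_le (by simp))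
    ((he.contDiffOn_temporalPart hf x k c).of_le (by simp))).trans (and_congr_right fun _ => ?_)
  refine forall_congr' fun v => ?_
  rw [extDeriv_temporalPart, he.extDerivCovector_self k x ht]
  simp only [spatialPart_self]
  rfl

/-- Closedness at one time and the evolution equation imply closedness on `G × T`. -/
theorem closedOn_evolForm (hT : Convex ℝ T) (hT' : (interior T).Nonempty)
    (he : IsSmoothCoframe T e) (hf : ContDiffOn ℝ ∞ f T) (i j k : Fin 3) (c : ℝ) {t₀ : ℝ}
    (ht₀ : t₀ ∈ T) (h₀ : ClosedOn (𝓡 3) univ (coframeWedge e i j t₀))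
    (h : HasTimeDerivOn T (coframeWedge e i j)
      (fun t x => -((c * f t) • extDerivCovector (𝓡 3) (e k t) x))) :
    ClosedOn ((𝓡 3).prod 𝓘(ℝ, ℝ)) (univ ×ˢ T) (evolForm e f i j k c) := by
  have hTu := uniqueDiffOn_convex hT hT'
  rintro ⟨x₀, t⟩ ⟨-, ht⟩
  rw [extDerivOn_evolForm_eq_zero_iff hTu he hf i j k c x₀ ht]
  refine ⟨?_, h t ht x₀⟩
  have hβ := he.contDiffOn_spatialPart x₀ i j
  have hγ := he.contDiffOn_temporalPart hf x₀ k c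
  have hU := isOpen_extChartAt_target (I := 𝓡 3) x₀
  have hΘ := hβ.cylinderForm hγ
  set U := (extChartAt (𝓡 3) x₀).target with hU_def
  set Θ := cylinderForm (spatialPart e x₀ i j) (temporalPart e f x₀ k c) with hΘ_def
  -- The constancy argument needs this on a whole cylinder, not only over `x₀`. The evolution
  -- equation at the point of `G` with coordinates `y` is evaluated on the images of `a` under the
  -- inverse chart, and `d eᵏ` there is rewritten in the chart at `x₀`.
  have hdt : ∀ q ∈ U ×ˢ T, ∀ a : Fin 2 → EuclideanSpace ℝ (Fin 3),
      extDerivWithin Θ (U ×ˢ T) q ![(0, 1), (a 0, 0), (a 1, 0)] = 0 := by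
    rintro ⟨y, r⟩ ⟨hy, hr⟩ a
    have hd := he.differentiableAt_covectorInChart k x₀ hr hy
    rw [extDerivWithin_cylinderForm_apply_dt hU hTu hy hr
      (hΘ.differentiableOn (by simp) _ ⟨hy, hr⟩) (hβ.differentiableOn (by simp) _ ⟨hy, hr⟩)
      (hd.const_smul (c * f r)), extDeriv_temporalPart]
    have hx := (extChartAt (𝓡 3) x₀).map_target hy
    have ht := h r hr ((extChartAt (𝓡 3) x₀).symm y) (fun i => mfderivWithin
      𝓘(ℝ, EuclideanSpace ℝ (Fin 3)) (𝓡 3) (extChartAt (𝓡 3) x₀).symm (range (𝓡 3)) y (a i))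
    have hdc := he.extDerivCovector_apply k x₀ hr hx (fun i => mfderivWithin
      𝓘(ℝ, EuclideanSpace ℝ (Fin 3)) (𝓡 3) (extChartAt (𝓡 3) x₀).symm (range (𝓡 3)) y (a i))
    have hinv (w : EuclideanSpace ℝ (Fin 3)) := DFunLike.congr_fun
      (mfderiv_extChartAt_comp_mfderivWithin_extChartAt_symm (I := 𝓡 3) hy) w
    rw [(extChartAt (𝓡 3) x₀).right_inv hy] at hdc
    have hβ_deriv : derivWithin (fun r => spatialPart e x₀ i j (y, r) a) T r =
        -((c * f r) • _) := ht.derivWithin (hTu r hr)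
    rw [hβ_deriv]
    refine neg_add_eq_zero.2 (congrArg ((c * f r) • ·) (hdc.trans (congrArg (extDeriv _ y) ?_)))
    exact funext fun l => hinv (a l)
  have hconst := extDerivWithin_spatial_const hU hT hT' (hΘ.of_le (WithTop.coe_le_coe.2 le_top)) hdt
    (mem_extChartAt_target x₀) ht ht₀
  have hspatial {r : ℝ} (hr : r ∈ T) (a : Fin 3 → EuclideanSpace ℝ (Fin 3)) :
      extDerivWithin Θ (U ×ˢ T) (extChartAt (𝓡 3) x₀ x₀, r) (fun i => (a i, 0)) =
        extDerivOn (𝓡 3) univ (coframeWedge e i j r) x₀ a := by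
    rw [extDerivOn_coframeWedge]
    exact extDerivWithin_apply_spatial hU hTu (mem_extChartAt_target x₀) hr
      (hΘ.differentiableOn (by simp) _ ⟨mem_extChartAt_target x₀, hr⟩)
      ((hβ.of_le (by simp)).differentiableAt_slice hU (mem_extChartAt_target x₀) hr)
      (fun z v => by simp [hΘ_def, cylinderForm_apply]) a
  -- The spatial part of `dΘ` at `x₀` takes the same value at `t` as at `t₀`, where it vanishes by
  -- `h₀`.
  refine ContinuousAlternatingMap.ext fun a => ?_
  refine (hspatial ht a).symm.trans ((hconst a).trans ((hspatial ht₀ a).trans ?_))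
  rw [h₀ x₀ (mem_univ _)]

end Evolution

/-! ### Uniqueness: the fundamental forms determine the structure -/

namespace AlmostHyperParahermitian

section

variable {E : Type*} [NormedAddCommGroup E] [NormedSpace ℝ E]
  {H : Type*} [TopologicalSpace H] {I : ModelWithCorners ℝ E H}
  {M : Type*} [TopologicalSpace M] [ChartedSpace H M] [IsManifold I ∞ M] {s : Set M}
  (A B : AlmostHyperParahermitian I s) {x : M}

theorem Ω₁_apply (hx : x ∈ s) (v w : TangentSpace I x) : A.Ω₁ x ![v, w] = A.g x v (A.J x w) := by
  rw [Ω₁, formOf, dif_pos hx]; rfl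

theorem Ω₂_apply (hx : x ∈ s) (v w : TangentSpace I x) : A.Ω₂ x ![v, w] = A.g x v (A.P₁ x w) := by
  rw [Ω₂, formOf, dif_pos hx]; rfl

theorem Ω₃_apply (hx : x ∈ s) (v w : TangentSpace I x) : A.Ω₃ x ![v, w] = A.g x v (A.P₂ x w) := by
  rw [Ω₃, formOf, dif_pos hx]; rfl

theorem Ω₁_nondegenerate (hx : x ∈ s) {w w' : TangentSpace I x}
    (h : ∀ v, A.Ω₁ x ![v, w] = A.Ω₁ x ![v, w']) : w = w' := by
  have h₁ : A.J x w = A.J x w' := by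
    refine sub_eq_zero.1 (A.nondegenerate x hx _ fun v => ?_)
    rw [A.symm x hx, map_sub, ← A.Ω₁_apply hx, ← A.Ω₁_apply hx, h, sub_self]
  have h₂ := congrArg (A.J x) h₁
  rwa [A.J_sq x hx, A.J_sq x hx, neg_inj] at h₂

variable {A B} in
/-- An almost hyper-parahermitian structure is determined by its fundamental forms. -/
theorem eq_of_fundamentalForms_eq (hx : x ∈ s) (h₁ : A.Ω₁ x = B.Ω₁ x) (h₂ : A.Ω₂ x = B.Ω₂ x)
    (h₃ : A.Ω₃ x = B.Ω₃ x) :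
    A.g x = B.g x ∧ A.J x = B.J x ∧ A.P₁ x = B.P₁ x ∧ A.P₂ x = B.P₂ x := by
  -- Since `J P₁ = P₂` and `J P₂ = -P₁`, inserting `P₁` or `P₂` into `Ω₁` yields another fundamental
  -- form, and nondegeneracy of `Ω₁` then isolates the endomorphism.
  have comp₁ (C : AlmostHyperParahermitian I s) (v w : TangentSpace I x) :
      C.Ω₁ x ![v, C.P₁ x w] = C.Ω₃ x ![v, w] := by
    rw [C.Ω₁_apply hx, C.J_P₁ x hx, C.Ω₃_apply hx]
  have comp₂ (C : AlmostHyperParahermitian I s) (v w : TangentSpace I x) :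
      C.Ω₁ x ![v, C.P₂ x w] = -C.Ω₂ x ![v, w] := by
    rw [C.Ω₁_apply hx, ← C.J_P₁ x hx, C.J_sq x hx, C.Ω₂_apply hx, map_neg]
  have J_eq (C : AlmostHyperParahermitian I s) (w : TangentSpace I x) :
      C.J x w = -C.P₁ x (C.P₂ x w) := by
    rw [← C.J_P₁ x hx w, C.P₁_J x hx, ← C.J_P₁ x hx, C.P₁_sq x hx, neg_neg]
  have hP₁ (w) : A.P₁ x w = B.P₁ x w := by
    refine A.Ω₁_nondegenerate hx fun v => ?_
    rw [comp₁, h₃, ← comp₁ B, h₁]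
  have hP₂ (w) : A.P₂ x w = B.P₂ x w := by
    refine A.Ω₁_nondegenerate hx fun v => ?_
    rw [comp₂, h₂, ← comp₂ B, h₁]
  have hJ (w) : A.J x w = B.J x w := by
    rw [J_eq, J_eq, hP₁, hP₂]
  have g_eq (C : AlmostHyperParahermitian I s) (v w : TangentSpace I x) :
      C.g x v w = -C.Ω₁ x ![v, C.J x w] := by
    rw [C.Ω₁_apply hx, C.J_sq x hx, map_neg, neg_neg]
  refine ⟨?_, ContinuousLinearMap.ext hJ, ContinuousLinearMap.ext hP₁,
    ContinuousLinearMap.ext hP₂⟩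
  refine ContinuousLinearMap.ext fun v => ContinuousLinearMap.ext fun w => ?_
  rw [g_eq, g_eq, hJ, h₁]

end

end AlmostHyperParahermitian

/-! ### Signature -/

/-- The diagonal quadratic form of signature `(2, 2)`. -/
def splitWeights : Fin 4 → ℝ := ![1, 1, -1, -1]

/-- By Sylvester's law of inertia it is enough to count the signs in one diagonalization. -/
theorem signature_of_split_form {V : Type*} [AddCommGroup V] [Module ℝ V] (Q : QuadraticForm ℝ V)
    (C : V ≃ₗ[ℝ] (Fin 4 → ℝ)) (h : ∀ v, Q v = C v 0 ^ 2 + C v 1 ^ 2 - C v 2 ^ 2 - C v 3 ^ 2) :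
    sigPos Q = 2 ∧ sigNeg Q = 2 := by
  have hQ : Q.Equivalent (QuadraticMap.weightedSumSquares ℝ splitWeights) := by
    refine ⟨⟨C, fun v => ?_⟩⟩
    rw [h]
    simp [QuadraticMap.weightedSumSquares_apply, Fin.sum_univ_four, splitWeights]
    ring
  constructor
  · rw [QuadraticForm.sigPos_of_equiv_weightedSumSquares hQ]
    have : {i | 0 < splitWeights i} = {0, 1} := by
      ext i; fin_cases i <;> norm_num [splitWeights]
    rw [this, ncard_pair (by decide)]
  · rw [QuadraticForm.sigNeg_of_equiv_weightedSumSquares hQ]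
    have : {i | splitWeights i < 0} = {2, 3} := by
      ext i; fin_cases i <;> norm_num [splitWeights] <;> decide
    rw [this, ncard_pair (by decide)]

/-! ### Smooth pullback of constant tensors by a coframe -/

section Coframe

variable {E : Type*} [NormedAddCommGroup E] [NormedSpace ℝ E]
  {H : Type*} [TopologicalSpace H] {I : ModelWithCorners ℝ E H}
  {M : Type*} [TopologicalSpace M] [ChartedSpace H M]
  {F : Type*} [NormedAddCommGroup F] [NormedSpace ℝ F]

/-- The pullback of a bilinear form on `F` by a field `C` of linear maps `T_x M → F`. -/
def pullbackBilin (B : F →L[ℝ] F →L[ℝ] ℝ) (C : (x : M) → TangentSpace I x →L[ℝ] F) (x : M) :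
    TangentSpace I x →L[ℝ] TangentSpace I x →L[ℝ] ℝ :=
  let c : E →L[ℝ] F := C x
  let b : E →L[ℝ] E →L[ℝ] ℝ := B.bilinearComp c c
  b

theorem pullbackBilin_apply (B : F →L[ℝ] F →L[ℝ] ℝ) (C : (x : M) → TangentSpace I x →L[ℝ] F)
    (x : M) (v w : TangentSpace I x) : pullbackBilin B C x v w = B (C x v) (C x w) := rfl

/-- The conjugate of an endomorphism of `F` by a field `C` of isomorphisms `T_x M → F`. -/
def pullbackEnd (K : F →L[ℝ] F) (C : (x : M) → TangentSpace I x →L[ℝ] F) (x : M) :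
    TangentSpace I x →L[ℝ] TangentSpace I x :=
  (C x).inverse.comp (K.comp (C x))

theorem apply_pullbackEnd (K : F →L[ℝ] F) (C : (x : M) → TangentSpace I x →L[ℝ] F)
    {x : M} (h : (C x).IsInvertible) (v : TangentSpace I x) :
    C x (pullbackEnd K C x v) = K (C x v) := h.self_apply_inverse _

variable [IsManifold I ∞ M]

/-- A field `C` of linear maps `T_x M → F`, in the trivialization of the tangent bundle at `x₀`. -/
def coframeInCoordinates (C : (x : M) → TangentSpace I x →L[ℝ] F) (x₀ x : M) : E →L[ℝ] F :=
  (C x).comp ((trivializationAt E (TangentSpace I) x₀).symmL ℝ x)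

variable {s : Set M} {C : (x : M) → TangentSpace I x →L[ℝ] F}

theorem contMDiffOn_pullbackBilin
    (hC : ∀ x₀ ∈ s, ContMDiffWithinAt I 𝓘(ℝ, E →L[ℝ] F) ∞ (coframeInCoordinates C x₀) s x₀)
    (B : F →L[ℝ] F →L[ℝ] ℝ) :
    ContMDiffOn I (I.prod 𝓘(ℝ, E →L[ℝ] E →L[ℝ] ℝ)) ∞
      (fun x => TotalSpace.mk' (E →L[ℝ] E →L[ℝ] ℝ)
      (E := fun x : M => TangentSpace I x →L[ℝ] TangentSpace I x →L[ℝ] ℝ) x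
        (pullbackBilin B C x)) s := by
  intro x₀ hx₀
  rw [contMDiffWithinAt_hom_bundle]
  -- In the trivialization at `x₀` the pulled-back form is the smooth expression `B(c ·, c ·)` in
  -- the local coframe matrix `c`, so smoothness of `c` is all that is needed.
  refine ⟨contMDiffWithinAt_id, ?_⟩
  have hpull : ContDiff ℝ ∞ fun c : E →L[ℝ] F => B.bilinearComp c c := by
    have : (fun c : E →L[ℝ] F => B.bilinearComp c c) = fun c : E →L[ℝ] F =>
        ((ContinuousLinearMap.compL ℝ E F ℝ).flip c).comp (B.comp c) := rfl
    rw [this]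
    fun_prop
  have hmem := mem_baseSet_trivializationAt E (TangentSpace I) x₀
  have heq {x : M} (hx : x ∈ (trivializationAt E (TangentSpace I) x₀).baseSet) :
      ContinuousLinearMap.inCoordinates E (TangentSpace I) (E →L[ℝ] ℝ)
        (fun x => TangentSpace I x →L[ℝ] ℝ) x₀ x x₀ x (pullbackBilin B C x) =
        B.bilinearComp (coframeInCoordinates C x₀ x) (coframeInCoordinates C x₀ x) := by
    ext v w
    refine (inCoordinates_apply_eq₂ hx hx (mem_univ x)).trans ?_
    simp [pullbackBilin_apply, coframeInCoordinates, Trivialization.symmL_apply _ hx]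
  refine (hpull.contMDiff.contMDiffAt.comp_contMDiffWithinAt x₀ (hC x₀ hx₀)).congr_of_eventuallyEq
    ?_ (heq hmem)
  filter_upwards [nhdsWithin_le_nhds
    ((trivializationAt E (TangentSpace I) x₀).open_baseSet.mem_nhds hmem)] with x hx using heq hx

theorem contMDiffOn_pullbackEnd [CompleteSpace E]
    (hC : ∀ x₀ ∈ s, ContMDiffWithinAt I 𝓘(ℝ, E →L[ℝ] F) ∞ (coframeInCoordinates C x₀) s x₀)
    (hC' : ∀ x ∈ s, (C x).IsInvertible) (K : F →L[ℝ] F) :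
    ContMDiffOn I (I.prod 𝓘(ℝ, E →L[ℝ] E)) ∞
      (fun x => TotalSpace.mk' (E →L[ℝ] E)
      (E := fun x : M => TangentSpace I x →L[ℝ] TangentSpace I x) x (pullbackEnd K C x)) s := by
  intro x₀ hx₀
  rw [contMDiffWithinAt_hom_bundle]
  refine ⟨contMDiffWithinAt_id, ?_⟩
  -- Here the local expression is `c⁻¹ K c`, smooth because inversion is smooth at invertible maps.
  have hpull {c : E →L[ℝ] F} (hc : c.IsInvertible) :
      ContDiffAt ℝ ∞ (fun c : E →L[ℝ] F => c.inverse.comp (K.comp c)) c :=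
    hc.contDiffAt_map_inverse.clm_comp (contDiffAt_const.clm_comp contDiffAt_id)
  have hinv {x : M} (hx : x ∈ (trivializationAt E (TangentSpace I) x₀).baseSet) (hxs : x ∈ s) :
      (coframeInCoordinates C x₀ x).IsInvertible := by
    have : (Trivialization.symmL ℝ (trivializationAt E (TangentSpace I) x₀) x).IsInvertible :=
      ⟨((trivializationAt E (TangentSpace I) x₀).continuousLinearEquivAt ℝ x hx).symm,
        Trivialization.symm_continuousLinearEquivAt_eq' _ hx⟩
    exact (hC' x hxs).comp this
  have heq {x : M} (hx : x ∈ (trivializationAt E (TangentSpace I) x₀).baseSet) (hxs : x ∈ s) :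
      ContinuousLinearMap.inCoordinates E (TangentSpace I) E (TangentSpace I) x₀ x x₀ x
        (pullbackEnd K C x) = (coframeInCoordinates C x₀ x).inverse.comp
          (K.comp (coframeInCoordinates C x₀ x)) := by
    ext v
    refine ((hinv hx hxs).inverse_apply_eq.2 ?_).symm
    set τ := trivializationAt E (TangentSpace I : M → Type _) x₀
    change K (C x (τ.symmL ℝ x v)) = C x (τ.symmL ℝ x (τ.continuousLinearMapAt ℝ x
      (pullbackEnd K C x (τ.symmL ℝ x v))))
    rw [Trivialization.symmL_continuousLinearMapAt _ hx, apply_pullbackEnd K C (hC' x hxs)]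
  have hmem := mem_baseSet_trivializationAt E (TangentSpace I) x₀
  refine ((hpull (hinv hmem hx₀)).contMDiffAt.comp_contMDiffWithinAt x₀
    (hC x₀ hx₀)).congr_of_eventuallyEq ?_ (heq hmem hx₀)
  filter_upwards [nhdsWithin_le_nhds
    ((trivializationAt E (TangentSpace I) x₀).open_baseSet.mem_nhds hmem),
    self_mem_nhdsWithin] with x hx hxs using heq hx hxs

end Coframe

theorem ContinuousLinearMap.isInvertible_of_injective_of_finrank_eq {V W : Type*}
    [NormedAddCommGroup V] [NormedSpace ℝ V] [FiniteDimensional ℝ V] [NormedAddCommGroup W]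
    [NormedSpace ℝ W] [FiniteDimensional ℝ W] {c : V →L[ℝ] W} (hc : ∀ v, c v = 0 → v = 0)
    (h : Module.finrank ℝ V = Module.finrank ℝ W) : c.IsInvertible :=
  ⟨(LinearMap.linearEquivOfInjective c.toLinearMap
    ((injective_iff_map_eq_zero c.toLinearMap).2 hc) h).toContinuousLinearEquiv, by ext v; rfl⟩

/-- A vector killed by a spanning family of functionals is killed by every functional, and
continuous functionals separate points. -/
theorem eq_zero_of_span_eq_top {V ι : Type*} [NormedAddCommGroup V] [NormedSpace ℝ V]
    {φ : ι → V →L[ℝ] ℝ} (hφ : Submodule.span ℝ (range φ) = ⊤) {v : V} (hv : ∀ i, φ i v = 0) :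
    v = 0 := by
  refine SeparatingDual.eq_zero_of_forall_dual_eq_zero (R := ℝ) fun g => ?_
  have hg : g ∈ Submodule.span ℝ (range φ) := hφ ▸ Submodule.mem_top
  induction hg using Submodule.span_induction with
  | mem g hg => obtain ⟨i, rfl⟩ := hg; exact hv i
  | zero => rfl
  | add g g' _ _ h h' => rw [add_apply, h, h', add_zero]
  | smul a g _ h => rw [smul_apply, h, smul_zero]

/-! ### The standard structure on `ℝ⁴` -/

section Standard

open ContinuousLinearMap in
/-- `u ↦ (-u₁, u₀, -u₃, u₂)`. -/
def stdJ : (Fin 4 → ℝ) →L[ℝ] (Fin 4 → ℝ) := .pi ![-proj 1, proj 0, -proj 3, proj 2]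

open ContinuousLinearMap in
/-- `u ↦ (u₂, -u₃, u₀, -u₁)`. -/
def stdP₁ : (Fin 4 → ℝ) →L[ℝ] (Fin 4 → ℝ) := .pi ![proj 2, -proj 3, proj 0, -proj 1]

open ContinuousLinearMap in
/-- `u ↦ (u₃, u₂, u₁, u₀)`. -/
def stdP₂ : (Fin 4 → ℝ) →L[ℝ] (Fin 4 → ℝ) := .pi ![proj 3, proj 2, proj 1, proj 0]

open ContinuousLinearMap in
/-- The symmetric bilinear form `diag(1, 1, -1, -1)`. -/
def stdBilin : (Fin 4 → ℝ) →L[ℝ] (Fin 4 → ℝ) →L[ℝ] ℝ :=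
  (proj 0).smulRight (proj 0 : (Fin 4 → ℝ) →L[ℝ] ℝ) +
    (proj 1).smulRight (proj 1 : (Fin 4 → ℝ) →L[ℝ] ℝ) -
    (proj 2).smulRight (proj 2 : (Fin 4 → ℝ) →L[ℝ] ℝ) -
    (proj 3).smulRight (proj 3 : (Fin 4 → ℝ) →L[ℝ] ℝ)

theorem stdJ_apply (u : Fin 4 → ℝ) : stdJ u = ![-u 1, u 0, -u 3, u 2] := by
  ext i; fin_cases i <;> rfl

theorem stdP₁_apply (u : Fin 4 → ℝ) : stdP₁ u = ![u 2, -u 3, u 0, -u 1] := by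
  ext i; fin_cases i <;> rfl

theorem stdP₂_apply (u : Fin 4 → ℝ) : stdP₂ u = ![u 3, u 2, u 1, u 0] := by
  ext i; fin_cases i <;> rfl

theorem stdBilin_apply (u w : Fin 4 → ℝ) :
    stdBilin u w = u 0 * w 0 + u 1 * w 1 - u 2 * w 2 - u 3 * w 3 := rfl

theorem stdBilin_nondegenerate {u : Fin 4 → ℝ} (h : ∀ w, stdBilin u w = 0) : u = 0 := by
  ext i
  have := h (Pi.single i 1)
  rw [stdBilin_apply] at this
  fin_cases i <;> simpa using this

end Standard

/-! ### The structure adapted to a coframe -/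

section OfCoframe

variable {E : Type*} [NormedAddCommGroup E] [NormedSpace ℝ E] [CompleteSpace E]
  {H : Type*} [TopologicalSpace H] {I : ModelWithCorners ℝ E H}
  {M : Type*} [TopologicalSpace M] [ChartedSpace H M] [IsManifold I ∞ M]
  {s : Set M} {C : (x : M) → TangentSpace I x →L[ℝ] (Fin 4 → ℝ)}

/-- The almost hyper-parahermitian structure for which the coframe `C` is adapted. -/
def AlmostHyperParahermitian.ofCoframe
    (hC : ∀ x₀ ∈ s, ContMDiffWithinAt I 𝓘(ℝ, E →L[ℝ] (Fin 4 → ℝ)) ∞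
      (coframeInCoordinates C x₀) s x₀)
    (hC' : ∀ x ∈ s, (C x).IsInvertible) : AlmostHyperParahermitian I s where
  g := pullbackBilin stdBilin C
  J := pullbackEnd stdJ C
  P₁ := pullbackEnd stdP₁ C
  P₂ := pullbackEnd stdP₂ C
  smooth_g := contMDiffOn_pullbackBilin hC stdBilin
  smooth_J := contMDiffOn_pullbackEnd hC hC' stdJ
  smooth_P₁ := contMDiffOn_pullbackEnd hC hC' stdP₁
  smooth_P₂ := contMDiffOn_pullbackEnd hC hC' stdP₂
  symm x _ v w := by
    rw [pullbackBilin_apply, pullbackBilin_apply, stdBilin_apply, stdBilin_apply]; ring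
  nondegenerate x hx v h := by
    refine (hC' x hx).injective ?_
    rw [map_zero]
    refine stdBilin_nondegenerate fun w => ?_
    have := h ((C x).inverse w)
    rwa [pullbackBilin_apply, (hC' x hx).self_apply_inverse] at this
  -- `C x` intertwines the pulled-back endomorphisms with the standard ones, so by injectivity each
  -- identity reduces to coordinates on `ℝ⁴`.
  J_sq x hx v := (hC' x hx).injective <| by
    simp_rw [apply_pullbackEnd _ _ (hC' x hx), map_neg, stdJ_apply]
    ext i; fin_cases i <;> simp
  P₁_sq x hx v := (hC' x hx).injective <| by
    simp_rw [apply_pullbackEnd _ _ (hC' x hx), stdP₁_apply]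
    ext i; fin_cases i <;> simp
  P₂_sq x hx v := (hC' x hx).injective <| by
    simp_rw [apply_pullbackEnd _ _ (hC' x hx), stdP₂_apply]
    ext i; fin_cases i <;> simp
  J_P₁ x hx v := (hC' x hx).injective <| by
    simp_rw [apply_pullbackEnd _ _ (hC' x hx), stdP₂_apply, stdP₁_apply, stdJ_apply]
    ext i; fin_cases i <;> simp
  P₁_J x hx v := (hC' x hx).injective <| by
    simp_rw [map_neg, apply_pullbackEnd _ _ (hC' x hx), stdP₂_apply, stdP₁_apply, stdJ_apply]
    ext i; fin_cases i <;> simp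
  g_J x hx v w := by
    simp_rw [pullbackBilin_apply, apply_pullbackEnd _ _ (hC' x hx), stdBilin_apply, stdJ_apply]
    simp; ring
  g_P₁ x hx v w := by
    simp_rw [pullbackBilin_apply, apply_pullbackEnd _ _ (hC' x hx), stdBilin_apply, stdP₁_apply]
    simp; ring
  g_P₂ x hx v w := by
    simp_rw [pullbackBilin_apply, apply_pullbackEnd _ _ (hC' x hx), stdBilin_apply, stdP₂_apply]
    simp; ring

end OfCoframe

/-! ### The coframe `(e¹, e², e³, f dt)`: invertibility and smoothness -/

section Evolution

variable {G : Type*} [TopologicalSpace G] [ChartedSpace (EuclideanSpace ℝ (Fin 3)) G]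

/-- The coframe `(e¹, e², e³, f dt)` on `G × ℝ`. -/
def evolCoframe (e : Fin 3 → ℝ → (x : G) → TangentSpace (𝓡 3) x →L[ℝ] ℝ) (f : ℝ → ℝ) (p : G × ℝ) :
    TangentSpace ((𝓡 3).prod 𝓘(ℝ, ℝ)) p →L[ℝ] (Fin 4 → ℝ) :=
  .pi ![spatial (e 0) p, spatial (e 1) p, spatial (e 2) p, temporal f p]

variable {T : Set ℝ} {e : Fin 3 → ℝ → (x : G) → TangentSpace (𝓡 3) x →L[ℝ] ℝ} {f : ℝ → ℝ}

theorem spatial_apply (α : ℝ → (x : G) → TangentSpace (𝓡 3) x →L[ℝ] ℝ) (p : G × ℝ)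
    (v : TangentSpace (𝓡 3) p.1 × TangentSpace 𝓘(ℝ, ℝ) p.2) :
    spatial α p v = α p.2 p.1 v.1 := by
  rw [spatial, mfderiv_fst]
  rfl

theorem temporal_apply (f : ℝ → ℝ) (p : G × ℝ)
    (v : EuclideanSpace ℝ (Fin 3) × ℝ) :
    temporal f p v = f p.2 * v.2 := by
  rw [temporal, mfderiv_snd]
  rfl

variable [IsManifold (𝓡 3) ∞ G]

theorem evolCoframe_isInvertible (he : IsSmoothCoframe T e) (hf₀ : ∀ t ∈ T, f t ≠ 0)
    {p : G × ℝ} (hp : p ∈ (univ : Set G) ×ˢ T) : (evolCoframe e f p).IsInvertible := by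
  have hinj : ∀ v : EuclideanSpace ℝ (Fin 3) × ℝ, evolCoframe e f p v = 0 → v = 0 := by
    intro v hv
    -- The last component kills the time part because `f ≠ 0`; the other three kill the spatial part
    -- because the `eⁱ` span. With `3 + 1 = 4`, injectivity is enough.
    have h₃ : f p.2 * v.2 = 0 := (temporal_apply f p v).symm.trans (congrFun hv 3)
    have h₂ : v.2 = 0 := (mul_eq_zero.1 h₃).resolve_left (hf₀ _ hp.2)
    have hi (i : Fin 3) : e i p.2 p.1 v.1 = 0 := by
      refine (spatial_apply (e i) p v).symm.trans ?_
      fin_cases i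
      exacts [congrFun hv 0, congrFun hv 1, congrFun hv 2]
    have h₁ : v.1 = 0 :=
      eq_zero_of_span_eq_top (V := EuclideanSpace ℝ (Fin 3)) (he.span _ hp.2 p.1) hi
    exact Prod.ext h₁ h₂
  exact ContinuousLinearMap.isInvertible_of_injective_of_finrank_eq
    (V := EuclideanSpace ℝ (Fin 3) × ℝ) hinj (by simp)

theorem contMDiffWithinAt_evolCoframe (he : IsSmoothCoframe T e) (hf : ContDiffOn ℝ ∞ f T)
    {p₀ : G × ℝ} (hp₀ : p₀ ∈ (univ : Set G) ×ˢ T) :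
    ContMDiffWithinAt ((𝓡 3).prod 𝓘(ℝ, ℝ))
      𝓘(ℝ, EuclideanSpace ℝ (Fin 3) × ℝ →L[ℝ] (Fin 4 → ℝ)) ∞
      (coframeInCoordinates (evolCoframe e f) p₀) (univ ×ˢ T) p₀ := by
  let c (q : EuclideanSpace ℝ (Fin 3) × ℝ) : EuclideanSpace ℝ (Fin 3) × ℝ →L[ℝ] (Fin 4 → ℝ) :=
    .pi ![(covectorInChart p₀.1 (e 0 q.2) q.1).comp (.fst ℝ _ ℝ),
      (covectorInChart p₀.1 (e 1 q.2) q.1).comp (.fst ℝ _ ℝ),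
      (covectorInChart p₀.1 (e 2 q.2) q.1).comp (.fst ℝ _ ℝ), f q.2 • .snd ℝ _ ℝ]
  have hc : ContDiffOn ℝ ∞ c ((extChartAt (𝓡 3) p₀.1).target ×ˢ T) := by
    have he' (i : Fin 3) (v : EuclideanSpace ℝ (Fin 3)) :=
      (he.contDiffOn_covectorInChart i p₀.1).clm_apply (contDiffOn_const (c := v))
    have hf' (r : ℝ) : ContDiffOn ℝ ∞ (fun q : EuclideanSpace ℝ (Fin 3) × ℝ => f q.2 * r)
        ((extChartAt (𝓡 3) p₀.1).target ×ˢ T) :=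
      (hf.comp contDiffOn_snd fun _ hq => hq.2).mul contDiffOn_const
    rw [contDiffOn_clm_apply]
    intro v
    rw [contDiffOn_pi]
    intro i
    fin_cases i
    exacts [he' 0 v.1, he' 1 v.1, he' 2 v.1, hf' v.2]
  have hsource (p : G × ℝ) (hp : p ∈ (extChartAt ((𝓡 3).prod 𝓘(ℝ, ℝ)) p₀).source) :
      p.1 ∈ (extChartAt (𝓡 3) p₀.1).source := by
    rw [extChartAt_prod] at hp
    exact hp.1
  have heq (p : G × ℝ) (hp : p ∈ (extChartAt ((𝓡 3).prod 𝓘(ℝ, ℝ)) p₀).source) :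
      coframeInCoordinates (evolCoframe e f) p₀ p =
        c (extChartAt ((𝓡 3).prod 𝓘(ℝ, ℝ)) p₀ p) := by
    have hq := (extChartAt (𝓡 3) p₀.1).map_source (hsource p hp)
    have hp' : p ∈ (chartAt (ModelProd (EuclideanSpace ℝ (Fin 3)) ℝ) p₀).source := by
      rwa [extChartAt_source] at hp
    rw [coframeInCoordinates, TangentBundle.symmL_trivializationAt hp']
    have hs (i : Fin 3) := spatial_comp_mfderivWithin_extChartAt_symm p₀.1 p₀.2 (e i)
      (q := extChartAt ((𝓡 3).prod 𝓘(ℝ, ℝ)) p₀ p) hq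
    have ht := temporal_comp_mfderivWithin_extChartAt_symm p₀.1 p₀.2 f
      (q := extChartAt ((𝓡 3).prod 𝓘(ℝ, ℝ)) p₀ p) hq
    -- `L` is typed on the fixed model space so that the base point can be rewritten along
    -- `left_inv`.
    have key (p' : G × ℝ) (h : p' = p) (L : EuclideanSpace ℝ (Fin 3) × ℝ →L[ℝ]
        EuclideanSpace ℝ (Fin 3) × ℝ) (v : EuclideanSpace ℝ (Fin 3) × ℝ) :
        evolCoframe e f p' (L v) = evolCoframe e f p (L v) := by rw [h]
    refine ContinuousLinearMap.ext fun v => funext fun i => ?_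
    refine (congrFun (key _ ((extChartAt ((𝓡 3).prod 𝓘(ℝ, ℝ)) p₀).left_inv hp) _ v).symm
      i).trans ?_
    fin_cases i
    exacts [DFunLike.congr_fun (hs 0) v, DFunLike.congr_fun (hs 1) v, DFunLike.congr_fun (hs 2) v,
      DFunLike.congr_fun ht v]
  have hmem := extChartAt_source_mem_nhds (I := (𝓡 3).prod 𝓘(ℝ, ℝ)) p₀
  rw [← contMDiffWithinAt_inter hmem]
  have hmaps : MapsTo (extChartAt ((𝓡 3).prod 𝓘(ℝ, ℝ)) p₀)
      (univ ×ˢ T ∩ (extChartAt ((𝓡 3).prod 𝓘(ℝ, ℝ)) p₀).source)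
      ((extChartAt (𝓡 3) p₀.1).target ×ˢ T) := by
    rintro p ⟨hpT, hp⟩
    exact ⟨(extChartAt (𝓡 3) p₀.1).map_source (hsource p hp), hpT.2⟩
  have hsm := ((hc _ (hmaps ⟨hp₀, mem_extChartAt_source p₀⟩)).contMDiffWithinAt).comp p₀
    (contMDiffAt_extChartAt (I := (𝓡 3).prod 𝓘(ℝ, ℝ)) (n := ∞)).contMDiffWithinAt hmaps
  exact hsm.congr (fun p hp => heq p hp.2) (heq p₀ (mem_extChartAt_source p₀))

end Evolution

/-! ### Fundamental forms, signature and the evolution equations -/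

section HyperSymplectic

variable {G : Type*} [TopologicalSpace G] [ChartedSpace (EuclideanSpace ℝ (Fin 3)) G]
  {T : Set ℝ} {e : Fin 3 → ℝ → (x : G) → TangentSpace (𝓡 3) x →L[ℝ] ℝ} {f : ℝ → ℝ}

theorem evolΩ₁_apply (p : G × ℝ) (v w : TangentSpace ((𝓡 3).prod 𝓘(ℝ, ℝ)) p) :
    evolΩ₁ e f p ![v, w] =
      -(spatial (e 0) p v * spatial (e 1) p w - spatial (e 0) p w * spatial (e 1) p v) +
        (spatial (e 2) p v * temporal f p w - spatial (e 2) p w * temporal f p v) := rfl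

theorem evolΩ₂_apply (p : G × ℝ) (v w : TangentSpace ((𝓡 3).prod 𝓘(ℝ, ℝ)) p) :
    evolΩ₂ e f p ![v, w] =
      (spatial (e 0) p v * spatial (e 2) p w - spatial (e 0) p w * spatial (e 2) p v) -
        (spatial (e 1) p v * temporal f p w - spatial (e 1) p w * temporal f p v) := rfl

theorem evolΩ₃_apply (p : G × ℝ) (v w : TangentSpace ((𝓡 3).prod 𝓘(ℝ, ℝ)) p) :
    evolΩ₃ e f p ![v, w] =
      (spatial (e 1) p v * spatial (e 2) p w - spatial (e 1) p w * spatial (e 2) p v) +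
        (spatial (e 0) p v * temporal f p w - spatial (e 0) p w * temporal f p v) := rfl

theorem alternatingForm_ext {V : Type*} [AddCommGroup V] [Module ℝ V] [TopologicalSpace V]
    {θ θ' : V [⋀^Fin 2]→L[ℝ] ℝ} (h : ∀ v w, θ ![v, w] = θ' ![v, w]) : θ = θ' := by
  ext u
  rw [show u = ![u 0, u 1] by ext i; fin_cases i <;> rfl]
  exact h _ _

theorem evolForm_apply (i j k : Fin 3) (c : ℝ) (p : G × ℝ)
    (v w : TangentSpace ((𝓡 3).prod 𝓘(ℝ, ℝ)) p) :
    evolForm e f i j k c p ![v, w] =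
      (spatial (e i) p v * spatial (e j) p w - spatial (e i) p w * spatial (e j) p v) +
        c * (spatial (e k) p v * temporal f p w - spatial (e k) p w * temporal f p v) := rfl

theorem evolΩ₁_eq (p : G × ℝ) : evolΩ₁ e f p = -evolForm e f 0 1 2 (-1) p := by
  refine alternatingForm_ext fun v w => (evolΩ₁_apply p v w).trans ?_
  refine Eq.trans ?_ (congrArg Neg.neg (evolForm_apply 0 1 2 (-1) p v w)).symm
  ring

theorem evolΩ₂_eq (p : G × ℝ) : evolΩ₂ e f p = evolForm e f 0 2 1 (-1) p := by
  refine alternatingForm_ext fun v w => (evolΩ₂_apply p v w).trans ?_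
  rw [evolForm_apply]
  ring

theorem evolΩ₃_eq (p : G × ℝ) : evolΩ₃ e f p = evolForm e f 1 2 0 1 p := by
  refine alternatingForm_ext fun v w => (evolΩ₃_apply p v w).trans ?_
  rw [evolForm_apply]
  ring

theorem HasTimeDerivOn.congr {θ η η' : ℝ → (x : G) → TangentSpace (𝓡 3) x [⋀^Fin 2]→L[ℝ] ℝ}
    (h : ∀ t x v, η t x v = η' t x v) : HasTimeDerivOn T θ η ↔ HasTimeDerivOn T θ η' :=
  forall₄_congr fun t _ x v => by rw [h t x v]

variable [IsManifold (𝓡 3) ∞ G]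

/-- The almost hyper-parahermitian structure on `G × T` adapted to `(e¹, e², e³, f dt)`. -/
def evolStructure (he : IsSmoothCoframe T e) (hf : ContDiffOn ℝ ∞ f T) (hf₀ : ∀ t ∈ T, f t ≠ 0) :
    AlmostHyperParahermitian ((𝓡 3).prod 𝓘(ℝ, ℝ)) ((univ : Set G) ×ˢ T) :=
  .ofCoframe (C := evolCoframe e f) (fun _ hp => contMDiffWithinAt_evolCoframe he hf hp)
    (fun _ hp => evolCoframe_isInvertible he hf₀ hp)

theorem evolStructure_g (he : IsSmoothCoframe T e) (hf : ContDiffOn ℝ ∞ f T)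
    (hf₀ : ∀ t ∈ T, f t ≠ 0) (p : G × ℝ) (v w : TangentSpace ((𝓡 3).prod 𝓘(ℝ, ℝ)) p) :
    (evolStructure he hf hf₀).g p v w = stdBilin (evolCoframe e f p v) (evolCoframe e f p w) :=
  pullbackBilin_apply _ _ _ _ _

theorem evolStructure_hasFundamentalForms (he : IsSmoothCoframe T e) (hf : ContDiffOn ℝ ∞ f T)
    (hf₀ : ∀ t ∈ T, f t ≠ 0) :
    (evolStructure he hf hf₀).HasFundamentalForms (evolΩ₁ e f) (evolΩ₂ e f) (evolΩ₃ e f) := by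
  intro p hp
  have hC := evolCoframe_isInvertible he hf₀ hp
  have hK (K : (Fin 4 → ℝ) →L[ℝ] (Fin 4 → ℝ)) (v w : TangentSpace ((𝓡 3).prod 𝓘(ℝ, ℝ)) p) :
      (evolStructure he hf hf₀).g p v (pullbackEnd K (evolCoframe e f) p w) =
        stdBilin (evolCoframe e f p v) (K (evolCoframe e f p w)) :=
    (evolStructure_g he hf hf₀ p v _).trans (congrArg _ (apply_pullbackEnd K _ hC w))
  refine ⟨alternatingForm_ext fun v w => ?_, alternatingForm_ext fun v w => ?_,
    alternatingForm_ext fun v w => ?_⟩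
  · refine (AlmostHyperParahermitian.Ω₁_apply _ hp v w).trans ((hK stdJ v w).trans ?_)
    rw [stdBilin_apply, stdJ_apply, evolΩ₁_apply]
    change spatial (e 0) p v * -(spatial (e 1) p w) + spatial (e 1) p v * spatial (e 0) p w -
      spatial (e 2) p v * -(temporal f p w) - temporal f p v * spatial (e 2) p w = _
    ring
  · refine (AlmostHyperParahermitian.Ω₂_apply _ hp v w).trans ((hK stdP₁ v w).trans ?_)
    rw [stdBilin_apply, stdP₁_apply, evolΩ₂_apply]
    change spatial (e 0) p v * spatial (e 2) p w + spatial (e 1) p v * -(temporal f p w) -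
      spatial (e 2) p v * spatial (e 0) p w - temporal f p v * -(spatial (e 1) p w) = _
    ring
  · refine (AlmostHyperParahermitian.Ω₃_apply _ hp v w).trans ((hK stdP₂ v w).trans ?_)
    rw [stdBilin_apply, stdP₂_apply, evolΩ₃_apply]
    change spatial (e 0) p v * temporal f p w + spatial (e 1) p v * spatial (e 2) p w -
      spatial (e 2) p v * spatial (e 1) p w - temporal f p v * spatial (e 0) p w = _
    ring

/-- `Q` is constrained only through its values, so the result also serves any other structure with
the same metric at `p`. -/
theorem evolStructure_signature (he : IsSmoothCoframe T e) (hf : ContDiffOn ℝ ∞ f T)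
    (hf₀ : ∀ t ∈ T, f t ≠ 0) {p : G × ℝ} (hp : p ∈ (univ : Set G) ×ˢ T)
    {Q : QuadraticForm ℝ (TangentSpace ((𝓡 3).prod 𝓘(ℝ, ℝ)) p)}
    (hQ : ∀ v, Q v = (evolStructure he hf hf₀).g p v v) : sigPos Q = 2 ∧ sigNeg Q = 2 := by
  obtain ⟨C, hC⟩ := evolCoframe_isInvertible he hf₀ hp
  refine signature_of_split_form Q C.toLinearEquiv fun v => ?_
  refine (hQ v).trans ((evolStructure_g he hf hf₀ p v v).trans ?_)
  have hv : C.toLinearEquiv v = evolCoframe e f p v := DFunLike.congr_fun hC v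
  rw [stdBilin_apply, hv]
  ring

theorem ClosedOn.evolForm_evolution (hT : UniqueDiffOn ℝ T) (he : IsSmoothCoframe T e)
    (hf : ContDiffOn ℝ ∞ f T) {i j k : Fin 3} {c : ℝ}
    (h : ClosedOn ((𝓡 3).prod 𝓘(ℝ, ℝ)) ((univ : Set G) ×ˢ T) (evolForm e f i j k c)) :
    (∀ t ∈ T, ClosedOn (𝓡 3) univ (coframeWedge e i j t)) ∧
      HasTimeDerivOn T (coframeWedge e i j)
        (fun t x => -((c * f t) • extDerivCovector (𝓡 3) (e k t) x)) := by
  have h' {t : ℝ} (ht : t ∈ T) (x : G) :=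
    (extDerivOn_evolForm_eq_zero_iff hT he hf i j k c x ht).1 (h (x, t) ⟨mem_univ x, ht⟩)
  exact ⟨fun t ht x _ => (h' ht x).1, fun t ht x => (h' ht x).2⟩

theorem closedOn_iff_evolForm (hT : UniqueDiffOn ℝ T) :
    (ClosedOn ((𝓡 3).prod 𝓘(ℝ, ℝ)) ((univ : Set G) ×ˢ T) (evolΩ₁ e f) ↔
      ClosedOn ((𝓡 3).prod 𝓘(ℝ, ℝ)) ((univ : Set G) ×ˢ T) (evolForm e f 0 1 2 (-1))) ∧
    (ClosedOn ((𝓡 3).prod 𝓘(ℝ, ℝ)) ((univ : Set G) ×ˢ T) (evolΩ₂ e f) ↔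
      ClosedOn ((𝓡 3).prod 𝓘(ℝ, ℝ)) ((univ : Set G) ×ˢ T) (evolForm e f 0 2 1 (-1))) ∧
    (ClosedOn ((𝓡 3).prod 𝓘(ℝ, ℝ)) ((univ : Set G) ×ˢ T) (evolΩ₃ e f) ↔
      ClosedOn ((𝓡 3).prod 𝓘(ℝ, ℝ)) ((univ : Set G) ×ˢ T) (evolForm e f 1 2 0 1)) := by
  refine ⟨?_, ClosedOn.congr _ fun p _ => evolΩ₂_eq p, ClosedOn.congr _ fun p _ => evolΩ₃_eq p⟩
  refine (ClosedOn.congr _ fun p _ => evolΩ₁_eq p).trans (ClosedOn.neg_iff _ ?_)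
  rintro ⟨x, t⟩ ⟨-, ht⟩
  rw [extChartAt_prod_symm_preimage]
  exact (uniqueDiffOn_univ.prod hT) _ ⟨mem_univ _, ht⟩

theorem closedOn_evolForms_iff (hT : T.OrdConnected) (hT' : T.Nontrivial)
    (he : IsSmoothCoframe T e) (hf : ContDiffOn ℝ ∞ f T) :
    (ClosedOn ((𝓡 3).prod 𝓘(ℝ, ℝ)) ((univ : Set G) ×ˢ T) (evolΩ₁ e f) ∧
      ClosedOn ((𝓡 3).prod 𝓘(ℝ, ℝ)) ((univ : Set G) ×ˢ T) (evolΩ₂ e f) ∧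
      ClosedOn ((𝓡 3).prod 𝓘(ℝ, ℝ)) ((univ : Set G) ×ˢ T) (evolΩ₃ e f)) ↔
    (∃ t₀ ∈ T, ClosedOn (𝓡 3) univ (coframeWedge e 0 1 t₀) ∧
      ClosedOn (𝓡 3) univ (coframeWedge e 0 2 t₀) ∧
      ClosedOn (𝓡 3) univ (coframeWedge e 1 2 t₀)) ∧
    HasTimeDerivOn T (coframeWedge e 0 1) (fun t x => f t • extDerivCovector (𝓡 3) (e 2 t) x) ∧
    HasTimeDerivOn T (coframeWedge e 0 2) (fun t x => f t • extDerivCovector (𝓡 3) (e 1 t) x) ∧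
    HasTimeDerivOn T (coframeWedge e 1 2)
      (fun t x => -(f t • extDerivCovector (𝓡 3) (e 0 t) x)) := by
  -- A nontrivial interval has interior; this gives uniqueness of derivatives within `T`, endpoints
  -- included.
  have hint : (interior T).Nonempty := by
    obtain ⟨a, ha, b, hb, hab⟩ := hT'.exists_lt
    exact (nonempty_Ioo.2 hab).mono
      (interior_maximal (Ioo_subset_Icc_self.trans (hT.out ha hb)) isOpen_Ioo)
  have hTu := uniqueDiffOn_convex hT.convex hint
  obtain ⟨h₁, h₂, h₃⟩ := closedOn_iff_evolForm (G := G) (e := e) (f := f) hTu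
  -- The general evolution equation has right-hand side `-c f deᵏ`: the first two forms have `c =
  -- -1`, the third `c = 1`, which accounts for the signs in the statement.
  have hneg (k : Fin 3) (t : ℝ) (x : G) (v : Fin 2 → TangentSpace (𝓡 3) x) :
      (-(((-1) * f t) • extDerivCovector (𝓡 3) (e k t) x)) v =
        (f t • extDerivCovector (𝓡 3) (e k t) x) v := by
    change -((-1 * f t) * extDerivCovector (𝓡 3) (e k t) x v) =
      f t * extDerivCovector (𝓡 3) (e k t) x v
    ring
  have hpos (k : Fin 3) (t : ℝ) (x : G) (v : Fin 2 → TangentSpace (𝓡 3) x) :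
      (-((1 * f t) • extDerivCovector (𝓡 3) (e k t) x)) v =
        (-(f t • extDerivCovector (𝓡 3) (e k t) x)) v := by
    rw [one_mul]
  rw [h₁, h₂, h₃, ← HasTimeDerivOn.congr (hneg 2), ← HasTimeDerivOn.congr (hneg 1),
    ← HasTimeDerivOn.congr (hpos 0)]
  constructor
  · rintro ⟨c₁, c₂, c₃⟩
    obtain ⟨a₁, b₁⟩ := c₁.evolForm_evolution hTu he hf
    obtain ⟨a₂, b₂⟩ := c₂.evolForm_evolution hTu he hf
    obtain ⟨a₃, b₃⟩ := c₃.evolForm_evolution hTu he hf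
    obtain ⟨t₀, ht₀⟩ := hT'.nonempty
    exact ⟨⟨t₀, ht₀, a₁ t₀ ht₀, a₂ t₀ ht₀, a₃ t₀ ht₀⟩, b₁, b₂, b₃⟩
  · rintro ⟨⟨t₀, ht₀, a₁, a₂, a₃⟩, b₁, b₂, b₃⟩
    exact ⟨closedOn_evolForm hT.convex hint he hf _ _ _ _ ht₀ a₁ b₁,
      closedOn_evolForm hT.convex hint he hf _ _ _ _ ht₀ a₂ b₂,
      closedOn_evolForm hT.convex hint he hf _ _ _ _ ht₀ a₃ b₃⟩

end HyperSymplectic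

theorem mainTheorem3 {G : Type*} [TopologicalSpace G] [ChartedSpace (EuclideanSpace ℝ (Fin 3)) G]
    [Group G] [LieGroup (𝓡 3) ∞ G]
    (T : Set ℝ) (hT : T.OrdConnected) (hT' : T.Nontrivial)
    (e : Fin 3 → ℝ → (x : G) → TangentSpace (𝓡 3) x →L[ℝ] ℝ) (he : IsSmoothCoframe T e)
    (f : ℝ → ℝ) (hf : ContDiffOn ℝ ∞ f T) (hf₀ : ∀ t ∈ T, f t ≠ 0) :
    -- the three 2-forms are the fundamental forms of an almost hyper-parahermitian structure
    (∃ A : AlmostHyperParahermitian ((𝓡 3).prod 𝓘(ℝ, ℝ)) ((univ : Set G) ×ˢ T),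
      A.HasFundamentalForms (evolΩ₁ e f) (evolΩ₂ e f) (evolΩ₃ e f)) ∧
    -- which is unique
    (∀ A B : AlmostHyperParahermitian ((𝓡 3).prod 𝓘(ℝ, ℝ)) ((univ : Set G) ×ˢ T),
      A.HasFundamentalForms (evolΩ₁ e f) (evolΩ₂ e f) (evolΩ₃ e f) →
      B.HasFundamentalForms (evolΩ₁ e f) (evolΩ₂ e f) (evolΩ₃ e f) →
      ∀ p ∈ (univ : Set G) ×ˢ T,
        A.g p = B.g p ∧ A.J p = B.J p ∧ A.P₁ p = B.P₁ p ∧ A.P₂ p = B.P₂ p) ∧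
    ∀ A : AlmostHyperParahermitian ((𝓡 3).prod 𝓘(ℝ, ℝ)) ((univ : Set G) ×ˢ T),
      A.HasFundamentalForms (evolΩ₁ e f) (evolΩ₂ e f) (evolΩ₃ e f) →
      (A.IsHyperSymplectic ↔
        (∃ t₀ ∈ T, ClosedOn (𝓡 3) univ (coframeWedge e 0 1 t₀) ∧
          ClosedOn (𝓡 3) univ (coframeWedge e 0 2 t₀) ∧
          ClosedOn (𝓡 3) univ (coframeWedge e 1 2 t₀)) ∧
        HasTimeDerivOn T (coframeWedge e 0 1)
          (fun t x => f t • extDerivCovector (𝓡 3) (e 2 t) x) ∧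
        HasTimeDerivOn T (coframeWedge e 0 2)
          (fun t x => f t • extDerivCovector (𝓡 3) (e 1 t) x) ∧
        HasTimeDerivOn T (coframeWedge e 1 2)
          (fun t x => -(f t • extDerivCovector (𝓡 3) (e 0 t) x))) ∧
      -- the metric is `(e¹)² + (e²)² - (e³)² - f² dt²`, of signature `(2, 2)`
      ∀ p ∈ (univ : Set G) ×ˢ T,
        (∀ v w, A.g p v w =
          spatial (e 0) p v * spatial (e 0) p w + spatial (e 1) p v * spatial (e 1) p w
            - spatial (e 2) p v * spatial (e 2) p w - temporal f p v * temporal f p w) ∧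
        sigPos (A.quadraticForm p) = 2 ∧ sigNeg (A.quadraticForm p) = 2 := by
  refine ⟨⟨evolStructure he hf hf₀, evolStructure_hasFundamentalForms he hf hf₀⟩,
    fun A B hA hB p hp => AlmostHyperParahermitian.eq_of_fundamentalForms_eq hp
      ((hA p hp).1.trans (hB p hp).1.symm) ((hA p hp).2.1.trans (hB p hp).2.1.symm)
      ((hA p hp).2.2.trans (hB p hp).2.2.symm), fun A hA => ⟨?_, fun p hp => ?_⟩⟩
  · exact (and_congr (ClosedOn.congr _ fun p hp => (hA p hp).1)
      (and_congr (ClosedOn.congr _ fun p hp => (hA p hp).2.1)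
        (ClosedOn.congr _ fun p hp => (hA p hp).2.2))).trans (closedOn_evolForms_iff hT hT' he hf)
  · have hB := evolStructure_hasFundamentalForms he hf hf₀ p hp
    -- Uniqueness identifies the metric of an arbitrary `A` with that of the adapted structure,
    -- where formula and signature are already known.
    have hg : A.g p = (evolStructure he hf hf₀).g p :=
      (AlmostHyperParahermitian.eq_of_fundamentalForms_eq hp ((hA p hp).1.trans hB.1.symm)
        ((hA p hp).2.1.trans hB.2.1.symm) ((hA p hp).2.2.trans hB.2.2.symm)).1
    have hg' (v w) : A.g p v w = (evolStructure he hf hf₀).g p v w := by rw [hg]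
    exact ⟨fun v w => (hg' v w).trans (evolStructure_g he hf hf₀ p v w),
      evolStructure_signature he hf hf₀ hp fun v => hg' v v⟩
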